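/- Let $d\ge 1$ be an integer, $\lambda>0$, and let $f_{in},f_{out},g:[0,\infty)\to[0,1]$ be Borel measurable functions such that $1\ge f_{in}(r)\ge f_{out}(r)\ge 0$ for all $r\ge 0$ and $\{r\ge 0: f_{in}(r)\ne f_{out}(r)\}$ has positive Lebesgue measure. Planted-partition graph $G$: let $\phi=\{X_1,X_2,\dots\}$ be a homogeneous Poisson point process of intensity $\lambda$ on $\mathbb R^d$, enumerated without repetition in order of non-decreasing $\ell^\infty$ norm; let $(Z_i)_i$ be i.i.d. uniform on $\{-1,+1\}$ and let $(U_{ij})_{i<j}$, $U_{ji}=U_{ij}$, be i.i.d. uniform on $[0,1]$, the families $(X_i)$, $(Z_i)$, $(U_{ij})$ being mutually independent. $G$ has vertex set $\phi$, and $X_i$, $X_j$ ($i\ne j$) are adjacent if and only if $U_{ij}\le f_{in}(\|X_i-X_j\|)\mathbf 1_{Z_i=Z_j}+f_{out}(\|X_i-X_j\|)\mathbf 1_{Z_i\ne Z_j}$, where $\|\cdot\|$ is the Euclidean norm. Random connection model $H_{\lambda,g,d}$: its vertex set is a homogeneous Poisson point process of intensity $\lambda$ on $\mathbb R^d$ and,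 with independent uniform pair marks as above, $X_i$, $X_j$ ($i\ne j$) are adjacent if and only if $U_{ij}\le g(\|X_i-X_j\|)$. Let $\mathbb M_{\mathcal G}(\mathbb R^d)$ be the space of simple graphs whose vertex set is a locally finite subset of $\mathbb R^d$, with the $\sigma$-algebra generated by the numbers of vertices in Borel subsets of $\mathbb R^d$ and the numbers of edges (ordered pairs of adjacent vertices) in Borel subsets of $\mathbb R^d\times\mathbb R^d$. Then $G$ and $H_{\lambda,g,d}$ are (a.e. measurable) random elements of $\mathbb M_{\mathcal G}(\mathbb R^d)$, and the probability measures that they induce on $\mathbb M_{\mathcal G}(\mathbb R^d)$ are mutually singular. -/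

import Mathlib

open MeasureTheory ProbabilityTheory
open scoped NNReal ENNReal

namespace SpatialPlantedPartition

/-! ### The space of spatial graphs -/

/-- A set of points of `ℝ^d` is locally finite if every ball contains finitely many of them. -/
def IsLocallyFiniteSet {d : ℕ} (s : Set (EuclideanSpace ℝ (Fin d))) : Prop :=
  ∀ r : ℝ, (s ∩ Metric.closedBall 0 r).Finite

/-- A simple spatial graph: a locally finite vertex set in `ℝ^d` with a symmetric, irreflexive
adjacency relation between vertices. -/
structure SpatialGraph (d : ℕ) where
  /-- the vertex set -/
  verts : Set (EuclideanSpace ℝ (Fin d))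
  /-- the adjacency relation; it relates vertices only -/
  graph : SimpleGraph (EuclideanSpace ℝ (Fin d))
  locallyFinite : IsLocallyFiniteSet verts
  left_mem : ∀ {a b}, graph.Adj a b → a ∈ verts

namespace SpatialGraph

/-- Number of vertices in `B`. -/
noncomputable def vertCount {d : ℕ} (B : Set (EuclideanSpace ℝ (Fin d))) (S : SpatialGraph d) :
    ℕ∞ :=
  {a | a ∈ S.verts ∧ a ∈ B}.encard

/-- Number of ordered pairs of adjacent vertices in `C ⊆ ℝ^d × ℝ^d`. -/
noncomputable def edgeCount {d : ℕ}
    (C : Set (EuclideanSpace ℝ (Fin d) × EuclideanSpace ℝ (Fin d))) (S : SpatialGraph d) : ℕ∞ :=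
  {p | S.graph.Adj p.1 p.2 ∧ p ∈ C}.encard

/-- The usual σ-algebra of a space of locally finite configurations: the smallest one for which
the numbers of vertices and of edges in Borel sets are measurable. -/
noncomputable instance instMeasurableSpace (d : ℕ) : MeasurableSpace (SpatialGraph d) :=
  (⨆ B : {B : Set (EuclideanSpace ℝ (Fin d)) // MeasurableSet B},
      MeasurableSpace.comap (vertCount B.1) inferInstance) ⊔
  (⨆ C : {C : Set (EuclideanSpace ℝ (Fin d) × EuclideanSpace ℝ (Fin d)) // MeasurableSet C},
      MeasurableSpace.comap (edgeCount C.1) inferInstance)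

/-- The spatial graph without vertices. -/
def empty (d : ℕ) : SpatialGraph d where
  verts := ∅
  graph := ⊥
  locallyFinite := fun r => by simp
  left_mem := fun h => h.elim

open Classical in
/-- The spatial graph with vertices `x 0, x 1, …`, in which `x i` and `x j` are adjacent when `i`
and `j` are adjacent in `Γ`. If the points are not locally finite (a null event below), the value
is the empty graph. -/
noncomputable def ofEnumeration {d : ℕ} (x : ℕ → EuclideanSpace ℝ (Fin d)) (Γ : SimpleGraph ℕ) :
    SpatialGraph d :=
  if hx : IsLocallyFiniteSet (Set.range x) then
    { verts := Set.range x
      graph :=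
        { Adj := fun a b => a ≠ b ∧ ∃ i j, Γ.Adj i j ∧ x i = a ∧ x j = b
          symm := ⟨fun _ _ ⟨hne, i, j, hij, hi, hj⟩ => ⟨hne.symm, j, i, hij.symm, hj, hi⟩⟩
          loopless := ⟨fun _ h => h.1 rfl⟩ }
      locallyFinite := hx
      left_mem := fun ⟨_, i, _, _, hi, _⟩ => ⟨i, hi⟩ }
  else empty d

end SpatialGraph

/-! ### The Poisson point process and its marks -/

/-- Number of points of the process in `B`. -/
noncomputable def pointCount {d : ℕ} {Ω : Type*} (X : ℕ → Ω → EuclideanSpace ℝ (Fin d))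
    (B : Set (EuclideanSpace ℝ (Fin d))) (ω : Ω) : ℕ∞ :=
  {i | X i ω ∈ B}.encard

/-- `X 0, X 1, …` enumerates, without repetitions and in the order of increasing `ℓ^∞` norm, the
points of a homogeneous Poisson point process of intensity `lam` on `ℝ^d`. -/
structure IsPoissonProcess {d : ℕ} {Ω : Type*} [MeasurableSpace Ω] (P : Measure Ω) (lam : ℝ≥0)
    (X : ℕ → Ω → EuclideanSpace ℝ (Fin d)) : Prop where
  measurable : ∀ i, Measurable (X i)
  injective : ∀ᵐ ω ∂P, Function.Injective fun i => X i ω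
  /-- `‖WithLp.ofLp x‖` is the sup norm of the coordinate vector of `x`. -/
  ordered : ∀ᵐ ω ∂P, ∀ i j, i ≤ j → ‖WithLp.ofLp (X i ω)‖ ≤ ‖WithLp.ofLp (X j ω)‖
  poisson : ∀ B, MeasurableSet B → Bornology.IsBounded B →
    P.map (pointCount X B) =
      (poissonMeasure (lam * (volume B).toNNReal)).map (fun n : ℕ => (n : ℕ∞))
  indep : ∀ (k : ℕ) (B : Fin k → Set (EuclideanSpace ℝ (Fin d))),
    (∀ i, MeasurableSet (B i)) → (∀ i, Bornology.IsBounded (B i)) →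
    Pairwise (fun i j => Disjoint (B i) (B j)) → iIndepFun (fun i => pointCount X (B i)) P

/-- The marks `U s(i, j)`, `i ≠ j`, are i.i.d. uniform on `[0,1]`. A mark is attached to an
unordered pair, so that `U s(i, j) = U s(j, i)`; the marks on the diagonal are never used. -/
structure IsUniformPairMarks {Ω : Type*} [MeasurableSpace Ω] (P : Measure Ω)
    (U : Sym2 ℕ → Ω → ℝ) : Prop where
  measurable : ∀ e, Measurable (U e)
  uniform : ∀ e, ¬ e.IsDiag → P.map (U e) = volume.restrict (Set.Icc 0 1)
  indep : iIndepFun (fun e : {e : Sym2 ℕ // ¬ e.IsDiag} => U e.1) P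

/-- The labels `Z i` are i.i.d. uniform on `{-1, +1}`. -/
structure IsUniformLabels {Ω : Type*} [MeasurableSpace Ω] (P : Measure Ω)
    (Z : ℕ → Ω → ℤˣ) : Prop where
  measurable : ∀ i, Measurable (Z i)
  uniform : ∀ i (s : ℤˣ), P {ω | Z i ω = s} = 1 / 2
  indep : iIndepFun Z P

/-- The random data behind the planted-partition model: a Poisson process `X`, labels `Z` and pair
marks `U`, the three families being independent of each other. -/
structure IsPlantedPartitionData {d : ℕ} {Ω : Type*} [MeasurableSpace Ω] (P : Measure Ω)
    (lam : ℝ≥0) (X : ℕ → Ω → EuclideanSpace ℝ (Fin d)) (Z : ℕ → Ω → ℤˣ)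
    (U : Sym2 ℕ → Ω → ℝ) : Prop where
  points : IsPoissonProcess P lam X
  labels : IsUniformLabels P Z
  marks : IsUniformPairMarks P U
  indep_labels_marks : IndepFun (fun ω (i : ℕ) => Z i ω)
    (fun ω (e : {e : Sym2 ℕ // ¬ e.IsDiag}) => U e.1 ω) P
  indep_points : IndepFun (fun ω (i : ℕ) => X i ω)
    (fun ω => ((fun i : ℕ => Z i ω), fun e : {e : Sym2 ℕ // ¬ e.IsDiag} => U e.1 ω)) P

/-- The random data behind the random connection model: a Poisson process `X` and independent pair
marks `U`. -/
structure IsConnectionData {d : ℕ} {Ω : Type*} [MeasurableSpace Ω] (P : Measure Ω)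
    (lam : ℝ≥0) (X : ℕ → Ω → EuclideanSpace ℝ (Fin d)) (U : Sym2 ℕ → Ω → ℝ) : Prop where
  points : IsPoissonProcess P lam X
  marks : IsUniformPairMarks P U
  indep_points : IndepFun (fun ω (i : ℕ) => X i ω)
    (fun ω (e : {e : Sym2 ℕ // ¬ e.IsDiag}) => U e.1 ω) P

/-! ### The two random graphs -/

/-- The graph on `ℕ` with an edge between `i ≠ j` when `u s(i, j) ≤ p s(i, j)`. -/
def thresholdGraph (u p : Sym2 ℕ → ℝ) : SimpleGraph ℕ where
  Adj i j := i ≠ j ∧ u s(i, j) ≤ p s(i, j)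
  symm := ⟨fun i j h => ⟨h.1.symm, by rw [Sym2.eq_swap]; exact h.2⟩⟩
  loopless := ⟨fun _ h => h.1 rfl⟩

/-- Edge probability of a pair under the planted partition: `fin ‖x i - x j‖` within a community
and `fout ‖x i - x j‖` across communities. -/
noncomputable def plantedProb {d : ℕ} (fin fout : ℝ≥0 → ℝ) (x : ℕ → EuclideanSpace ℝ (Fin d))
    (z : ℕ → ℤˣ) : Sym2 ℕ → ℝ :=
  Sym2.lift ⟨fun i j => if z i = z j then fin (nndist (x i) (x j)) else fout (nndist (x i) (x j)),
    fun i j => by simp only [eq_comm (a := z i), nndist_comm (x i)]⟩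

/-- Edge probability of a pair in the random connection model: `g ‖x i - x j‖`. -/
noncomputable def connectionProb {d : ℕ} (g : ℝ≥0 → ℝ) (x : ℕ → EuclideanSpace ℝ (Fin d)) :
    Sym2 ℕ → ℝ :=
  Sym2.lift ⟨fun i j => g (nndist (x i) (x j)), fun i j => by simp only [nndist_comm (x i)]⟩

/-- The planted-partition random connection model `G`, as a random spatial graph. -/
noncomputable def plantedPartitionGraph {d : ℕ} {Ω : Type*} (fin fout : ℝ≥0 → ℝ)
    (X : ℕ → Ω → EuclideanSpace ℝ (Fin d)) (Z : ℕ → Ω → ℤˣ) (U : Sym2 ℕ → Ω → ℝ) (ω : Ω) :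
    SpatialGraph d :=
  SpatialGraph.ofEnumeration (fun i => X i ω)
    (thresholdGraph (fun e => U e ω) (plantedProb fin fout (fun i => X i ω) (fun i => Z i ω)))

/-- The random connection model `H` with connection function `g`, as a random spatial graph. -/
noncomputable def randomConnectionGraph {d : ℕ} {Ω : Type*} (g : ℝ≥0 → ℝ)
    (X : ℕ → Ω → EuclideanSpace ℝ (Fin d)) (U : Sym2 ℕ → Ω → ℝ) (ω : Ω) : SpatialGraph d :=
  SpatialGraph.ofEnumeration (fun i => X i ω)
    (thresholdGraph (fun e => U e ω) (connectionProb g (fun i => X i ω)))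

end SpatialPlantedPartition

namespace SpatialPlantedPartition

/-! ### Measurability of the random graphs -/

/-! The two laws are separated by the asymptotic frequency of a local pattern. A pattern asks for
exactly one vertex in each of finitely many disjoint bounded boxes and for an edge between certain
pairs of boxes. By `map_randomGraph_patternEvent` its probability is the integral of `edgeWeight`
(the edge probability given the positions, averaged over labels) against the product of the measures
`boxMeasure`. This number does not change when all boxes are translated together, and two translates
that do not meet give independent events (`map_patternEvent_inter`). Along a sequence of such
translates the strong law makes the frequency of the pattern converge almost surely to its
probability. Hence one pattern with different probabilities in the two models suffices
(`mutuallySingular_of_lintegral_edgeWeight_ne`).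

Such a pattern exists on four vertices (`exists_lintegral_edgeWeight_ne`). If all probabilities
agreed, shrinking the boxes would force the edge weights to agree at almost every configuration
(`ae_edgeWeight_eq`). A single edge then gives `g = (fin + fout) / 2` at its length. Given the
labels, an edge of the planted model has probability `m + z z' δ`, where `m` is the mean and `δ` the
half difference of `fin` and `fout`. Expand the product around a four-cycle and average over the
labels: only edge sets with all degrees even survive, namely the empty set and the whole cycle. The
result is `∏ m + ∏ δ` (`average_labels_fourCycle`), against `∏ g = ∏ m` in the other model. So `∏ δ`
would vanish at almost every configuration. But four-cycles with all sides in `{fin ≠ fout}` have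
positive measure (`not_ae_exists_nndist_notMem`). The cycle is bipartite for this reason: a triangle
with all sides in a given set of distances need not exist. -/

lemma measurable_encard_setOf {ι Ω : Type*} [Countable ι] [MeasurableSpace Ω] {p : ι → Ω → Prop}
    (hp : ∀ i, MeasurableSet {ω | p i ω}) : Measurable fun ω => {i | p i ω}.encard :=
  measurable_encard.comp (measurable_set_iff.2 fun i => measurableSet_setOfPred.1 (hp i))

variable {d : ℕ}

/-- Injectivity turns counts of points into counts of indices, whose measurability in `ω` is a
countable matter. -/
lemma vertCount_ofEnumeration {x : ℕ → EuclideanSpace ℝ (Fin d)} (hx : Function.Injective x)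
    (hlf : IsLocallyFiniteSet (Set.range x)) (Γ : SimpleGraph ℕ)
    (B : Set (EuclideanSpace ℝ (Fin d))) :
    SpatialGraph.vertCount B (SpatialGraph.ofEnumeration x Γ) = {i | x i ∈ B}.encard := by
  rw [SpatialGraph.ofEnumeration, dif_pos hlf, SpatialGraph.vertCount, ← hx.encard_image]
  congr 1
  ext a
  constructor
  · rintro ⟨⟨i, rfl⟩, h⟩
    exact ⟨i, h, rfl⟩
  · rintro ⟨i, h, rfl⟩
    exact ⟨⟨i, rfl⟩, h⟩

lemma edgeCount_ofEnumeration {x : ℕ → EuclideanSpace ℝ (Fin d)} (hx : Function.Injective x)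
    (hlf : IsLocallyFiniteSet (Set.range x)) (Γ : SimpleGraph ℕ)
    (C : Set (EuclideanSpace ℝ (Fin d) × EuclideanSpace ℝ (Fin d))) :
    SpatialGraph.edgeCount C (SpatialGraph.ofEnumeration x Γ) =
      {p : ℕ × ℕ | Γ.Adj p.1 p.2 ∧ (x p.1, x p.2) ∈ C}.encard := by
  rw [SpatialGraph.ofEnumeration, dif_pos hlf, SpatialGraph.edgeCount,
    ← (hx.prodMap hx).encard_image]
  congr 1
  ext ⟨a, b⟩
  constructor
  · rintro ⟨⟨_, i, j, h, rfl, rfl⟩, hC⟩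
    exact ⟨(i, j), ⟨h, hC⟩, rfl⟩
  · rintro ⟨⟨i, j⟩, ⟨h, hC⟩, hab⟩
    obtain ⟨rfl, rfl⟩ := Prod.mk.inj hab
    exact ⟨⟨fun h' => h.ne (hx h'), i, j, h, rfl, rfl⟩, hC⟩

lemma measurable_spatialGraph {Ω : Type*} [MeasurableSpace Ω] {f : Ω → SpatialGraph d}
    (hv : ∀ B, MeasurableSet B → Measurable fun ω => SpatialGraph.vertCount B (f ω))
    (he : ∀ C, MeasurableSet C → Measurable fun ω => SpatialGraph.edgeCount C (f ω)) :
    Measurable f := by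
  rw [measurable_iff_comap_le, SpatialGraph.instMeasurableSpace, MeasurableSpace.comap_sup,
    MeasurableSpace.comap_iSup, MeasurableSpace.comap_iSup]
  refine sup_le (iSup_le fun B => ?_) (iSup_le fun C => ?_)
  · rw [MeasurableSpace.comap_comp]
    exact (hv B.1 B.2).comap_le
  · rw [MeasurableSpace.comap_comp]
    exact (he C.1 C.2).comap_le

lemma measurable_vertCount {B : Set (EuclideanSpace ℝ (Fin d))} (hB : MeasurableSet B) :
    Measurable (SpatialGraph.vertCount B) := by
  rw [measurable_iff_comap_le, SpatialGraph.instMeasurableSpace]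
  exact le_sup_of_le_left (le_iSup_of_le ⟨B, hB⟩ le_rfl)

lemma measurable_edgeCount
    {C : Set (EuclideanSpace ℝ (Fin d) × EuclideanSpace ℝ (Fin d))} (hC : MeasurableSet C) :
    Measurable (SpatialGraph.edgeCount C) := by
  rw [measurable_iff_comap_le, SpatialGraph.instMeasurableSpace]
  exact le_sup_of_le_right (le_iSup_of_le ⟨C, hC⟩ le_rfl)

variable {Ω : Type*} {X : ℕ → Ω → EuclideanSpace ℝ (Fin d)}

/-- The realisations that enumerate a locally finite set without repetitions. -/
def regularEvent (X : ℕ → Ω → EuclideanSpace ℝ (Fin d)) : Set Ω :=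
  {ω | (∀ i j, i ≠ j → X i ω ≠ X j ω) ∧ ∀ r : ℕ, pointCount X (Metric.closedBall 0 r) ω ≠ ⊤}

lemma injective_of_mem_regularEvent {ω : Ω} (h : ω ∈ regularEvent X) :
    Function.Injective fun i => X i ω := fun i j hij => by
  by_contra hne
  exact h.1 i j hne hij

lemma isLocallyFiniteSet_of_mem_regularEvent {ω : Ω} (h : ω ∈ regularEvent X) :
    IsLocallyFiniteSet (Set.range fun i => X i ω) := by
  intro r
  obtain ⟨n, hn⟩ := exists_nat_ge r
  have hfin : {i | X i ω ∈ Metric.closedBall 0 (n : ℝ)}.Finite :=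
    Set.encard_ne_top_iff.1 (h.2 n)
  refine (hfin.image fun i => X i ω).subset ?_
  rintro _ ⟨⟨i, rfl⟩, hi⟩
  exact ⟨i, Metric.closedBall_subset_closedBall hn hi, rfl⟩

/-- The random spatial graph with points `X i` and index graph `Γ`. -/
noncomputable def randomGraph (X : ℕ → Ω → EuclideanSpace ℝ (Fin d)) (Γ : Ω → SimpleGraph ℕ)
    (ω : Ω) : SpatialGraph d :=
  SpatialGraph.ofEnumeration (fun i => X i ω) (Γ ω)

variable [MeasurableSpace Ω] {P : Measure Ω} {lam : ℝ≥0}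

lemma measurable_pointCount (hX : ∀ i, Measurable (X i)) {B : Set (EuclideanSpace ℝ (Fin d))}
    (hB : MeasurableSet B) : Measurable (pointCount X B) :=
  measurable_encard_setOf fun i => hX i hB

lemma IsPoissonProcess.measure_pointCount_eq (hX : IsPoissonProcess P lam X)
    {B : Set (EuclideanSpace ℝ (Fin d))} (hB : MeasurableSet B) (hb : Bornology.IsBounded B)
    (n : ℕ) : P {ω | pointCount X B ω = n} =
      ENNReal.ofReal (Real.exp (-(lam * (volume B).toNNReal : ℝ≥0)) *
        (lam * (volume B).toNNReal : ℝ≥0) ^ n / n.factorial) := by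
  have h := congrArg (fun μ => μ {(n : ℕ∞)}) (hX.poisson B hB hb)
  rw [Measure.map_apply (measurable_pointCount hX.measurable hB) (measurableSet_singleton _),
    Measure.map_apply (by fun_prop) (measurableSet_singleton _)] at h
  have hs : (fun n : ℕ => (n : ℕ∞)) ⁻¹' {(n : ℕ∞)} = {n} := by
    ext m; simp
  rw [hs, poissonMeasure_singleton] at h
  exact h

lemma IsPoissonProcess.ae_pointCount_ne_top (hX : IsPoissonProcess P lam X)
    {B : Set (EuclideanSpace ℝ (Fin d))} (hB : MeasurableSet B) (hb : Bornology.IsBounded B) :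
    ∀ᵐ ω ∂P, pointCount X B ω ≠ ⊤ := by
  have h := congrArg (fun μ => μ {(⊤ : ℕ∞)}) (hX.poisson B hB hb)
  rw [Measure.map_apply (measurable_pointCount hX.measurable hB) (measurableSet_singleton _),
    Measure.map_apply (by fun_prop) (measurableSet_singleton _)] at h
  have hs : (fun n : ℕ => (n : ℕ∞)) ⁻¹' {(⊤ : ℕ∞)} = ∅ := by
    ext m; simp
  rw [hs, measure_empty] at h
  rw [ae_iff]
  simp only [not_not]
  exact h

lemma measurableSet_regularEvent (hX : ∀ i, Measurable (X i)) :
    MeasurableSet (regularEvent X) := by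
  refine MeasurableSet.inter (s₁ := {ω | ∀ i j, i ≠ j → X i ω ≠ X j ω})
    (s₂ := {ω | ∀ r : ℕ, pointCount X (Metric.closedBall 0 r) ω ≠ ⊤}) ?_ ?_
  · simp only [Set.ofPred_forall]
    exact MeasurableSet.iInter fun i => MeasurableSet.iInter fun j => MeasurableSet.iInter
      fun _ => (measurableSet_eq_fun (hX i) (hX j)).compl
  · simp only [Set.ofPred_forall]
    exact MeasurableSet.iInter fun r => (measurable_pointCount hX
      Metric.isClosed_closedBall.measurableSet (measurableSet_singleton (⊤ : ℕ∞))).compl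

lemma IsPoissonProcess.ae_mem_regularEvent (hX : IsPoissonProcess P lam X) :
    ∀ᵐ ω ∂P, ω ∈ regularEvent X := by
  have h : ∀ᵐ ω ∂P, ∀ r : ℕ, pointCount X (Metric.closedBall 0 r) ω ≠ ⊤ :=
    ae_all_iff.2 fun r => hX.ae_pointCount_ne_top Metric.isClosed_closedBall.measurableSet
      Metric.isBounded_closedBall
  filter_upwards [hX.injective, h] with ω h1 h2
  exact ⟨fun i j hij h => hij (h1 h), h2⟩

/-- Counts of indices equal counts of vertices and edges only on the regular event. Replacing the
graph by the empty one elsewhere gives a measurable version, equal almost everywhere. -/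
lemma aemeasurable_randomGraph (hX : IsPoissonProcess P lam X) {Γ : Ω → SimpleGraph ℕ}
    (hΓ : ∀ i j, MeasurableSet {ω | (Γ ω).Adj i j}) : AEMeasurable (randomGraph X Γ) P := by
  classical
  have hreg := measurableSet_regularEvent hX.measurable
  refine ⟨fun ω => if ω ∈ regularEvent X then randomGraph X Γ ω else SpatialGraph.empty d,
    ?_, ?_⟩
  · refine measurable_spatialGraph (fun B hB => ?_) (fun C hC => ?_)
    · have : (fun ω => SpatialGraph.vertCount B
          (if ω ∈ regularEvent X then randomGraph X Γ ω else SpatialGraph.empty d)) =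
          fun ω => if ω ∈ regularEvent X then pointCount X B ω else
            SpatialGraph.vertCount B (SpatialGraph.empty d) := by
        ext1 ω
        split_ifs with h
        · exact vertCount_ofEnumeration (injective_of_mem_regularEvent h)
            (isLocallyFiniteSet_of_mem_regularEvent h) _ _
        · rfl
      rw [this]
      exact Measurable.ite hreg (measurable_pointCount hX.measurable hB) measurable_const
    · have : (fun ω => SpatialGraph.edgeCount C
          (if ω ∈ regularEvent X then randomGraph X Γ ω else SpatialGraph.empty d)) =
          fun ω => if ω ∈ regularEvent X then
            {p : ℕ × ℕ | (Γ ω).Adj p.1 p.2 ∧ (X p.1 ω, X p.2 ω) ∈ C}.encard else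
            SpatialGraph.edgeCount C (SpatialGraph.empty d) := by
        ext1 ω
        split_ifs with h
        · exact edgeCount_ofEnumeration (injective_of_mem_regularEvent h)
            (isLocallyFiniteSet_of_mem_regularEvent h) _ _
        · rfl
      rw [this]
      exact Measurable.ite hreg (measurable_encard_setOf fun p => (hΓ p.1 p.2).inter
        (((hX.measurable p.1).prodMk (hX.measurable p.2)) hC)) measurable_const
  · filter_upwards [hX.ae_mem_regularEvent] with ω h
    rw [if_pos h]

end SpatialPlantedPartition

namespace SpatialPlantedPartition

/-! ### Probability of seeing prescribed edges between prescribed boxes -/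

variable {d : ℕ} {ι K : Type}

/-- A family of pairwise distinct edges of the complete graph on `ι`. -/
def IsEdgeFamily {ι K : Type} (e : K → ι × ι) : Prop :=
  (∀ k, (e k).1 ≠ (e k).2) ∧ Function.Injective fun k => s((e k).1, (e k).2)

/-- Spatial graphs with exactly one vertex in each `B i` and with all the edges `e`. -/
def patternEvent (e : K → ι × ι) (B : ι → Set (EuclideanSpace ℝ (Fin d))) :
    Set (SpatialGraph d) :=
  {S | (∀ i, SpatialGraph.vertCount (B i) S = 1) ∧
    ∀ k, SpatialGraph.edgeCount (B (e k).1 ×ˢ B (e k).2) S ≠ 0}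

lemma measurableSet_patternEvent [Countable ι] [Countable K] (e : K → ι × ι)
    {B : ι → Set (EuclideanSpace ℝ (Fin d))}
    (hB : ∀ i, MeasurableSet (B i)) : MeasurableSet (patternEvent e B) := by
  refine MeasurableSet.inter (s₁ := {S | ∀ i, SpatialGraph.vertCount (B i) S = 1})
    (s₂ := {S | ∀ k, SpatialGraph.edgeCount (B (e k).1 ×ˢ B (e k).2) S ≠ 0}) ?_ ?_
  · simp only [Set.ofPred_forall]
    exact MeasurableSet.iInter fun i => measurable_vertCount (hB i) (measurableSet_singleton 1)
  · simp only [Set.ofPred_forall]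
    exact MeasurableSet.iInter fun k => (measurable_edgeCount ((hB _).prod (hB _))
      (measurableSet_singleton 0)).compl

/-- Point sequences whose only member in `B i` is the one with index `j i`. -/
def uniqueIn (B : ι → Set (EuclideanSpace ℝ (Fin d))) (j : ι → ℕ) :
    Set (ℕ → EuclideanSpace ℝ (Fin d)) :=
  {x | ∀ i n, x n ∈ B i ↔ n = j i}

lemma measurableSet_uniqueIn [Countable ι] {B : ι → Set (EuclideanSpace ℝ (Fin d))}
    (hB : ∀ i, MeasurableSet (B i)) (j : ι → ℕ) : MeasurableSet (uniqueIn B j) := by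
  simp only [uniqueIn, Set.ofPred_forall]
  refine MeasurableSet.iInter fun i => MeasurableSet.iInter fun n => ?_
  by_cases h : n = j i
  · simp only [h, iff_true]
    exact measurable_pi_apply _ (hB i)
  · simp only [h, iff_false]
    exact (measurable_pi_apply (X := fun _ => EuclideanSpace ℝ (Fin d)) n (hB i)).compl

/-- Ensures that only injective `j` contribute to the decomposition by indices, as the edge law
requires. -/
lemma injective_of_mem_uniqueIn {B : ι → Set (EuclideanSpace ℝ (Fin d))}
    (hd : Pairwise (Function.onFun Disjoint B)) {j : ι → ℕ}
    {x : ℕ → EuclideanSpace ℝ (Fin d)} (hx : x ∈ uniqueIn B j) : Function.Injective j := by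
  intro a b hab
  by_contra hne
  exact Set.disjoint_left.1 (hd hne) ((hx a (j a)).2 rfl) ((hx b (j a)).2 hab)

lemma eq_of_mem_uniqueIn {B : ι → Set (EuclideanSpace ℝ (Fin d))} {j j' : ι → ℕ}
    {x : ℕ → EuclideanSpace ℝ (Fin d)} (hx : x ∈ uniqueIn B j) (hx' : x ∈ uniqueIn B j') :
    j = j' :=
  funext fun i => (hx' i (j i)).1 ((hx i (j i)).2 rfl)

lemma encard_eq_one_iff_forall {s : Set ℕ} : s.encard = 1 ↔ ∃ m, ∀ n, n ∈ s ↔ n = m := by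
  rw [Set.encard_eq_one]
  exact exists_congr fun m => by simp [Set.ext_iff]

/-- The map `j` names the vertex found in each box. It is determined by `x`, so the pattern event
splits into countably many disjoint events on indices. -/
lemma ofEnumeration_mem_patternEvent_iff {x : ℕ → EuclideanSpace ℝ (Fin d)}
    (hx : Function.Injective x) (hlf : IsLocallyFiniteSet (Set.range x)) (Γ : SimpleGraph ℕ)
    (e : K → ι × ι) (B : ι → Set (EuclideanSpace ℝ (Fin d))) :
    SpatialGraph.ofEnumeration x Γ ∈ patternEvent e B ↔
      ∃ j : ι → ℕ, x ∈ uniqueIn B j ∧ ∀ k, Γ.Adj (j (e k).1) (j (e k).2) := by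
  simp only [patternEvent, Set.mem_ofPred_eq, vertCount_ofEnumeration hx hlf,
    edgeCount_ofEnumeration hx hlf, encard_eq_one_iff_forall, Set.encard_ne_zero]
  constructor
  · rintro ⟨h1, h2⟩
    choose j hj using h1
    refine ⟨j, hj, fun k => ?_⟩
    obtain ⟨⟨a, b⟩, hab, ha, hb⟩ := h2 k
    rw [← (hj _ a).1 ha, ← (hj _ b).1 hb]
    exact hab
  · rintro ⟨j, hj, hadj⟩
    exact ⟨fun i => ⟨j i, hj i⟩, fun k => ⟨(j (e k).1, j (e k).2), hadj k,
      (hj _ _).2 rfl, (hj _ _).2 rfl⟩⟩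

variable [Fintype ι] [DecidableEq ι] [Fintype K]

/-- Edge probability at distance `r` given the labels `s`, `t`. -/
noncomputable def edgeProb (fin fout : ℝ≥0 → ℝ) (s t : ℤˣ) (r : ℝ≥0) : ℝ :=
  if s = t then fin r else fout r

/-- The probability, given the positions `x`, that the vertices are joined by all the edges `e`,
averaged over the labels. -/
noncomputable def edgeWeight (fin fout : ℝ≥0 → ℝ) (e : K → ι × ι)
    (x : ι → EuclideanSpace ℝ (Fin d)) : ℝ≥0∞ :=
  ∑ s : ι → ℤˣ, (2⁻¹ : ℝ≥0∞) ^ Fintype.card ι * ∏ k, ENNReal.ofReal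
    (edgeProb fin fout (s (e k).1) (s (e k).2) (nndist (x (e k).1) (x (e k).2)))

lemma measurable_edgeProb {fin fout : ℝ≥0 → ℝ} (h1 : Measurable fin) (h2 : Measurable fout)
    (s t : ℤˣ) : Measurable (edgeProb fin fout s t) := by
  unfold edgeProb
  split_ifs <;> assumption

lemma measurable_edgeWeight {fin fout : ℝ≥0 → ℝ} (h1 : Measurable fin) (h2 : Measurable fout)
    (e : K → ι × ι) : Measurable (edgeWeight (d := d) fin fout e) := by
  unfold edgeWeight
  refine Finset.measurable_fun_sum _ fun s _ => Measurable.const_mul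
    (Finset.measurable_fun_prod _ fun k _ => ?_) _
  have h : Measurable fun x : ι → EuclideanSpace ℝ (Fin d) => nndist (x (e k).1) (x (e k).2) :=
    (measurable_pi_apply _).nndist (measurable_pi_apply _)
  exact ((measurable_edgeProb h1 h2 _ _).comp h).ennreal_ofReal

/-- Conditionally on the points, averaged over labels, the edges of the index graph `Γ` are
independent with probabilities given by `edgeProb`. -/
structure HasEdgeLaw {Ω : Type*} [MeasurableSpace Ω] (P : Measure Ω)
    (X : ℕ → Ω → EuclideanSpace ℝ (Fin d)) (Γ : Ω → SimpleGraph ℕ) (fin fout : ℝ≥0 → ℝ) :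
    Prop where
  measurableSet_adj : ∀ i j, MeasurableSet {ω | (Γ ω).Adj i j}
  edges : ∀ {ι K : Type} [Fintype ι] [DecidableEq ι] [Fintype K] (e : K → ι × ι),
    IsEdgeFamily e → ∀ j : ι → ℕ, Function.Injective j →
    ∀ C : Set (ℕ → EuclideanSpace ℝ (Fin d)), MeasurableSet C →
      P {ω | (fun i => X i ω) ∈ C ∧ ∀ k, (Γ ω).Adj (j (e k).1) (j (e k).2)} =
        ∫⁻ ω in {ω | (fun i => X i ω) ∈ C}, edgeWeight fin fout e (fun i => X (j i) ω) ∂P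

/-- The intensity of the position of the vertex in `B` on the event that there is just one. -/
noncomputable def boxMeasure (lam : ℝ≥0) (B : Set (EuclideanSpace ℝ (Fin d))) :
    Measure (EuclideanSpace ℝ (Fin d)) :=
  ENNReal.ofReal (lam * Real.exp (-(lam * (volume B).toReal))) • volume.restrict B

lemma isFiniteMeasure_boxMeasure (lam : ℝ≥0) {B : Set (EuclideanSpace ℝ (Fin d))}
    (hb : Bornology.IsBounded B) : IsFiniteMeasure (boxMeasure lam B) := by
  have : IsFiniteMeasure (volume.restrict B) := ⟨by
    rw [Measure.restrict_apply_univ]; exact hb.measure_lt_top⟩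
  exact Measure.smul_finite _ ENNReal.ofReal_ne_top

variable {Ω : Type*} [MeasurableSpace Ω] {P : Measure Ω} {lam : ℝ≥0}
  {X : ℕ → Ω → EuclideanSpace ℝ (Fin d)}

lemma IsPoissonProcess.measure_iInter_pointCount (hX : IsPoissonProcess P lam X)
    {κ : Type*} [Fintype κ] (B : κ → Set (EuclideanSpace ℝ (Fin d)))
    (hB : ∀ i, MeasurableSet (B i)) (hb : ∀ i, Bornology.IsBounded (B i))
    (hdisj : Pairwise (Function.onFun Disjoint B)) (n : κ → ℕ) :
    P {ω | ∀ i, pointCount X (B i) ω = n i} = ∏ i, P {ω | pointCount X (B i) ω = n i} := by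
  have h := (hX.indep (Fintype.card κ) (fun i => B ((Fintype.equivFin κ).symm i))
    (fun i => hB _) (fun i => hb _)
    (fun i j hij => hdisj ((Fintype.equivFin κ).symm.injective.ne hij))).precomp
    (Fintype.equivFin κ).injective
  simp only [Equiv.symm_apply_apply] at h
  have := h.meas_iInter (s := fun i => {ω | pointCount X (B i) ω = n i})
    (fun i => ⟨{(n i : ℕ∞)}, measurableSet_singleton _, rfl⟩)
  rw [← this]
  congr 1
  ext ω
  simp

/-- The two void factors multiply to `exp (-λ|B|)`, which no longer depends on `A`; what remains is
`λ|B ∩ A|`, a measure in `A`. -/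
lemma IsPoissonProcess.measure_pointCount_split (hX : IsPoissonProcess P lam X)
    {B A : Set (EuclideanSpace ℝ (Fin d))} (hB : MeasurableSet B) (hb : Bornology.IsBounded B)
    (hA : MeasurableSet A) :
    P {ω | pointCount X (B ∩ A) ω = (1 : ℕ)} * P {ω | pointCount X (B \ A) ω = (0 : ℕ)} =
      boxMeasure lam B A := by
  have h1 : volume (B ∩ A) ≠ ∞ := (hb.subset Set.inter_subset_left).measure_lt_top.ne
  have h2 : volume (B \ A) ≠ ∞ := (hb.subset Set.sdiff_subset).measure_lt_top.ne
  have h3 : (volume B).toReal = (volume (B ∩ A)).toReal + (volume (B \ A)).toReal := by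
    rw [← ENNReal.toReal_add h1 h2, measure_inter_add_sdiff B hA]
  rw [hX.measure_pointCount_eq (hB.inter hA) (hb.subset Set.inter_subset_left),
    hX.measure_pointCount_eq (hB.diff hA) (hb.subset Set.sdiff_subset), boxMeasure,
    Measure.smul_apply, Measure.restrict_apply hA, smul_eq_mul, Set.inter_comm A B,
    ← ENNReal.ofReal_toReal h1, ← ENNReal.ofReal_mul (by positivity),
    ← ENNReal.ofReal_mul (by positivity), h3]
  congr 1
  simp only [ENNReal.ofReal_toReal h1, NNReal.coe_mul, ENNReal.coe_toNNReal_eq_toReal, mul_add,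
    neg_add, Real.exp_add, pow_one, pow_zero, Nat.factorial]
  push_cast
  ring

/-- The joint intensity of the positions of the vertices in the `B i` when each of these sets
contains exactly one. -/
lemma IsPoissonProcess.sum_map_restrict_uniqueIn (hX : IsPoissonProcess P lam X)
    {B : ι → Set (EuclideanSpace ℝ (Fin d))} (hB : ∀ i, MeasurableSet (B i))
    (hb : ∀ i, Bornology.IsBounded (B i)) (hdisj : Pairwise (Function.onFun Disjoint B)) :
    Measure.sum (fun j : ι → ℕ =>
      (P.restrict {ω | (fun n => X n ω) ∈ uniqueIn B j}).map fun ω i => X (j i) ω) =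
      Measure.pi fun i => boxMeasure lam (B i) := by
  have hmeas : Measurable fun ω n => X n ω := measurable_pi_iff.2 hX.measurable
  have := fun i => isFiniteMeasure_boxMeasure lam (hb i)
  refine (Measure.pi_eq fun A hA => ?_).symm
  have hms : ∀ j : ι → ℕ, MeasurableSet {ω | (fun i => X (j i) ω) ∈ Set.univ.pi A} := fun j =>
    (measurable_pi_iff.2 fun i => hX.measurable (j i)) (MeasurableSet.univ_pi hA)
  have hmu : ∀ j : ι → ℕ, MeasurableSet {ω | (fun n => X n ω) ∈ uniqueIn B j} := fun j =>
    hmeas (measurableSet_uniqueIn hB j)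
  have h1 : ∀ j : ι → ℕ, (P.restrict {ω | (fun n => X n ω) ∈ uniqueIn B j}).map
      (fun ω i => X (j i) ω) (Set.univ.pi A) =
      P ({ω | (fun i => X (j i) ω) ∈ Set.univ.pi A} ∩
        {ω | (fun n => X n ω) ∈ uniqueIn B j}) := fun j => by
    rw [Measure.map_apply (measurable_pi_iff.2 fun i => hX.measurable (j i))
      (MeasurableSet.univ_pi hA)]
    exact Measure.restrict_apply (hms j)
  rw [Measure.sum_apply _ (MeasurableSet.univ_pi hA)]
  simp_rw [h1]
  rw [← measure_iUnion (fun j j' hne => Set.disjoint_left.2 fun ω h h' =>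
    hne (eq_of_mem_uniqueIn h.2 h'.2)) (fun j => (hms j).inter (hmu j))]
  -- "The only point of `B i` lies in `A i`" means one point in `B i ∩ A i` and none in `B i \ A i`.
  -- These sets are disjoint, so independence of the counts applies.
  let D : ι × Bool → Set (EuclideanSpace ℝ (Fin d)) :=
    fun p => if p.2 then B p.1 ∩ A p.1 else B p.1 \ A p.1
  have hDm : ∀ p, MeasurableSet (D p) := by
    rintro ⟨i, _ | _⟩
    · exact (hB i).diff (hA i)
    · exact (hB i).inter (hA i)
  have hDB : ∀ p, D p ⊆ B p.1 := by
    rintro ⟨i, _ | _⟩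
    · exact Set.sdiff_subset
    · exact Set.inter_subset_left
  have hDd : Pairwise (Function.onFun Disjoint D) := by
    rintro ⟨i, a⟩ ⟨i', a'⟩ hne
    by_cases h : i = i'
    · subst h
      rcases a with _ | _ <;> rcases a' with _ | _
      · exact absurd rfl hne
      · exact Set.disjoint_left.2 fun y hy hy' => hy.2 hy'.2
      · exact Set.disjoint_left.2 fun y hy hy' => hy'.2 hy.2
      · exact absurd rfl hne
    · exact (hdisj h).mono (hDB (i, a)) (hDB (i', a'))
  have h2 : (⋃ j : ι → ℕ, {ω | (fun i => X (j i) ω) ∈ Set.univ.pi A} ∩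
      {ω | (fun n => X n ω) ∈ uniqueIn B j}) =
      {ω | ∀ p : ι × Bool, pointCount X (D p) ω = ((if p.2 then 1 else 0 : ℕ) : ℕ∞)} := by
    ext ω
    simp only [Set.mem_iUnion, Set.mem_inter_iff, Set.mem_ofPred_eq, Set.mem_univ_pi]
    constructor
    · rintro ⟨j, hjA, hj⟩ ⟨i, _ | _⟩
      · simp only [pointCount, D, Bool.false_eq_true, if_false, Nat.cast_zero, Set.encard_eq_zero]
        ext n
        simp only [Set.mem_ofPred_eq, Set.mem_sdiff, Set.mem_empty_iff_false, iff_false]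
        rintro ⟨hn, hn'⟩
        rw [(hj i n).1 hn] at hn'
        exact hn' (hjA i)
      · simp only [pointCount, D, if_true, Nat.cast_one]
        refine encard_eq_one_iff_forall.2 ⟨j i, fun n => ⟨fun hn => (hj i n).1 hn.1, ?_⟩⟩
        rintro rfl
        exact ⟨(hj i _).2 rfl, hjA i⟩
    · intro h
      have h0 : ∀ i n, X n ω ∈ B i → X n ω ∈ A i := by
        intro i n hn
        have := h (i, false)
        simp only [pointCount, D, Bool.false_eq_true, if_false, Nat.cast_zero,
          Set.encard_eq_zero] at this
        by_contra hn'
        exact (this ▸ (⟨hn, hn'⟩ : n ∈ {n | X n ω ∈ B i \ A i}) : n ∈ (∅ : Set ℕ))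
      have h1 : ∀ i, ∃ m, ∀ n, X n ω ∈ B i ∩ A i ↔ n = m := by
        intro i
        have := h (i, true)
        simp only [pointCount, D, if_true, Nat.cast_one] at this
        exact encard_eq_one_iff_forall.1 this
      choose j hj using h1
      exact ⟨j, fun i => ((hj i _).2 rfl).2, fun i n =>
        ⟨fun hn => (hj i n).1 ⟨hn, h0 i n hn⟩, fun hn => ((hj i n).2 hn).1⟩⟩
  rw [h2, hX.measure_iInter_pointCount D hDm (fun p => (hb p.1).subset (hDB p)) hDd,
    Fintype.prod_prod_type]
  refine Finset.prod_congr rfl fun i _ => ?_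
  rw [Fintype.prod_bool]
  exact hX.measure_pointCount_split (hB i) (hb i) (hA i)

/-- Sum over the indices `j` of the vertices in the boxes: the edge law integrates out labels and
marks for each `j`, and the laws of the positions add up to a product measure. -/
theorem map_randomGraph_patternEvent (hX : IsPoissonProcess P lam X) {Γ : Ω → SimpleGraph ℕ}
    {fin fout : ℝ≥0 → ℝ} (h1 : Measurable fin) (h2 : Measurable fout)
    (hΓ : HasEdgeLaw P X Γ fin fout) {e : K → ι × ι} (he : IsEdgeFamily e)
    {B : ι → Set (EuclideanSpace ℝ (Fin d))} (hB : ∀ i, MeasurableSet (B i))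
    (hb : ∀ i, Bornology.IsBounded (B i)) (hdisj : Pairwise (Function.onFun Disjoint B)) :
    P.map (randomGraph X Γ) (patternEvent e B) =
      ∫⁻ x, edgeWeight fin fout e x ∂Measure.pi fun i => boxMeasure lam (B i) := by
  have hmeas : Measurable fun ω n => X n ω := measurable_pi_iff.2 hX.measurable
  rw [Measure.map_apply_of_aemeasurable (aemeasurable_randomGraph hX hΓ.measurableSet_adj)
    (measurableSet_patternEvent e hB), ← hX.sum_map_restrict_uniqueIn hB hb hdisj,
    lintegral_sum_measure]
  have h3 : P (randomGraph X Γ ⁻¹' patternEvent e B) =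
      P (⋃ j : ι → ℕ, {ω | (fun n => X n ω) ∈ uniqueIn B j ∧
        ∀ k, (Γ ω).Adj (j (e k).1) (j (e k).2)}) := by
    refine measure_congr ?_
    filter_upwards [hX.ae_mem_regularEvent] with ω hω
    refine propext ?_
    have := ofEnumeration_mem_patternEvent_iff (injective_of_mem_regularEvent hω)
      (isLocallyFiniteSet_of_mem_regularEvent hω) (Γ ω) e B
    refine Iff.trans this ?_
    exact (Set.mem_iUnion (x := ω) (s := fun j : ι → ℕ => {ω | (fun n => X n ω) ∈ uniqueIn B j ∧
        ∀ k, (Γ ω).Adj (j (e k).1) (j (e k).2)})).symm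
  rw [h3, measure_iUnion]
  · refine tsum_congr fun j => ?_
    rw [lintegral_map (measurable_edgeWeight h1 h2 e)
      (measurable_pi_iff.2 fun i => hX.measurable (j i))]
    by_cases hj : Function.Injective j
    · exact hΓ.edges e he j hj _ (measurableSet_uniqueIn hB j)
    -- A non-injective `j` contributes zero to both sides.
    · have h4 : uniqueIn B j = ∅ := Set.eq_empty_of_forall_notMem fun x hx =>
        hj (injective_of_mem_uniqueIn hdisj hx)
      simp [h4]
  · exact fun j j' hne => Set.disjoint_left.2 fun ω h h' => hne (eq_of_mem_uniqueIn h.1 h'.1)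
  · intro j
    refine MeasurableSet.inter (hmeas (measurableSet_uniqueIn hB j)) ?_
    have : MeasurableSet {ω | ∀ k, (Γ ω).Adj (j (e k).1) (j (e k).2)} := by
      simp only [Set.ofPred_forall]
      exact MeasurableSet.iInter fun k => hΓ.measurableSet_adj _ _
    exact this

end SpatialPlantedPartition

namespace SpatialPlantedPartition

/-! ### The edge laws of the two models -/

/-- Fubini for independent variables: `f` is frozen and the probability is taken over `g` alone.
This is how the points are conditioned upon. -/
lemma measure_prodMk_mem_of_indepFun {Ω α β : Type*} [MeasurableSpace Ω] [MeasurableSpace α]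
    [MeasurableSpace β] {P : Measure Ω} [IsProbabilityMeasure P] {f : Ω → α} {g : Ω → β}
    (hf : Measurable f) (hg : Measurable g) (hfg : IndepFun f g P) {D : Set (α × β)}
    (hD : MeasurableSet D) :
    P {ω | (f ω, g ω) ∈ D} = ∫⁻ ω, P {ω' | (f ω, g ω') ∈ D} ∂P := by
  have h := (indepFun_iff_map_prod_eq_prod_map_map hf.aemeasurable hg.aemeasurable).1 hfg
  have h1 : P {ω | (f ω, g ω) ∈ D} = P.map (fun ω => (f ω, g ω)) D := by
    rw [Measure.map_apply (hf.prodMk hg) hD]; rfl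
  rw [h1, h, Measure.prod_apply hD, lintegral_map (measurable_measure_prodMk_left hD) hf]
  refine lintegral_congr fun ω => ?_
  rw [Measure.map_apply hg (measurable_prodMk_left hD)]
  rfl

instance : MeasurableSingletonClass ℤˣ where
  measurableSet_singleton s := by
    refine ⟨{(s : ℤ)}, measurableSet_singleton _, ?_⟩
    ext t
    simp [Units.ext_iff]

/-- The index pairs carrying a mark. -/
abbrev MarkIndex : Type := {e : Sym2 ℕ // ¬ e.IsDiag}

variable {d : ℕ} {Ω : Type*} [MeasurableSpace Ω] {P : Measure Ω} {lam : ℝ≥0}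

lemma IsUniformPairMarks.measure_forall_le {U : Sym2 ℕ → Ω → ℝ} (hU : IsUniformPairMarks P U)
    {K : Type} [Fintype K] {m : K → MarkIndex} (hm : Function.Injective m) {t : K → ℝ}
    (h1 : ∀ k, t k ≤ 1) :
    P {ω | ∀ k, U (m k).1 ω ≤ t k} = ∏ k, ENNReal.ofReal (t k) := by
  have h := (hU.indep.precomp hm).meas_iInter (s := fun k => {ω | U (m k).1 ω ≤ t k})
    (fun k => ⟨Set.Iic (t k), measurableSet_Iic, rfl⟩)
  have h2 : {ω | ∀ k, U (m k).1 ω ≤ t k} = ⋂ k, {ω | U (m k).1 ω ≤ t k} := by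
    ext ω; simp
  rw [h2, h]
  refine Finset.prod_congr rfl fun k _ => ?_
  have h3 : P {ω | U (m k).1 ω ≤ t k} = P.map (U (m k).1) (Set.Iic (t k)) := by
    rw [Measure.map_apply (hU.measurable _) measurableSet_Iic]; rfl
  have h4 : Set.Iic (t k) ∩ Set.Icc 0 1 = Set.Icc 0 (t k) := by
    ext y
    simp only [Set.mem_inter_iff, Set.mem_Iic, Set.mem_Icc]
    exact ⟨fun h => ⟨h.2.1, h.1⟩, fun h => ⟨h.2, h.1, h.2.trans (h1 k)⟩⟩
  rw [h3, hU.uniform _ (m k).2, Measure.restrict_apply measurableSet_Iic, h4, Real.volume_Icc,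
    sub_zero]

/-- The mark indices of the edges `e` placed at the indices `j`. -/
def markIndex {ι K : Type} {e : K → ι × ι} (he : IsEdgeFamily e) {j : ι → ℕ}
    (hj : Function.Injective j) (k : K) : MarkIndex :=
  ⟨s(j (e k).1, j (e k).2), by
    rw [Sym2.mk_isDiag_iff]
    exact hj.ne (he.1 k)⟩

/-- Distinct edges use distinct marks, which is what makes them conditionally independent. -/
lemma markIndex_injective {ι K : Type} {e : K → ι × ι} (he : IsEdgeFamily e) {j : ι → ℕ}
    (hj : Function.Injective j) : Function.Injective (markIndex he hj) := by
  intro k k' h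
  apply he.2
  have h' : Sym2.map j s((e k).1, (e k).2) = Sym2.map j s((e k').1, (e k').2) := by
    simpa [markIndex] using h
  exact Sym2.map.injective hj h'

lemma edgeProb_le_one {fin fout : ℝ≥0 → ℝ} (hf : ∀ r, 1 ≥ fin r ∧ fin r ≥ fout r ∧ fout r ≥ 0)
    (s t : ℤˣ) (r : ℝ≥0) : edgeProb fin fout s t r ≤ 1 := by
  unfold edgeProb
  obtain ⟨h1, h2, h3⟩ := hf r
  split_ifs <;> linarith

lemma IsUniformLabels.measure_forall_eq {Z : ℕ → Ω → ℤˣ} (hZ : IsUniformLabels P Z)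
    {ι : Type} [Fintype ι] {j : ι → ℕ} (hj : Function.Injective j) (s : ι → ℤˣ) :
    P {ω | ∀ i, Z (j i) ω = s i} = (2⁻¹ : ℝ≥0∞) ^ Fintype.card ι := by
  have h := (hZ.indep.precomp hj).meas_iInter (s := fun i => {ω | Z (j i) ω = s i})
    (fun i => ⟨{s i}, measurableSet_singleton _, rfl⟩)
  have h2 : {ω | ∀ i, Z (j i) ω = s i} = ⋂ i, {ω | Z (j i) ω = s i} := by
    ext ω; simp
  rw [h2, h]
  simp [hZ.uniform]

variable {X : ℕ → Ω → EuclideanSpace ℝ (Fin d)} {Z : ℕ → Ω → ℤˣ} {U : Sym2 ℕ → Ω → ℝ}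

/-- Split by the values of the finitely many labels involved; for fixed labels the thresholds are
constants and the marks are independent. -/
lemma IsPlantedPartitionData.measure_forall_le (hG : IsPlantedPartitionData P lam X Z U)
    {fin fout : ℝ≥0 → ℝ} (hf : ∀ r, 1 ≥ fin r ∧ fin r ≥ fout r ∧ fout r ≥ 0)
    {ι K : Type} [Fintype ι] [DecidableEq ι] [Fintype K] {e : K → ι × ι} (he : IsEdgeFamily e)
    {j : ι → ℕ} (hj : Function.Injective j) (x : ι → EuclideanSpace ℝ (Fin d)) :
    P {ω | ∀ k, U (markIndex he hj k).1 ω ≤ edgeProb fin fout (Z (j (e k).1) ω)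
      (Z (j (e k).2) ω) (nndist (x (e k).1) (x (e k).2))} = edgeWeight fin fout e x := by
  let A : (ι → ℤˣ) → Set Ω := fun s => {ω | ∀ i, Z (j i) ω = s i}
  let D : (ι → ℤˣ) → Set Ω := fun s => {ω | ∀ k, U (markIndex he hj k).1 ω ≤
    edgeProb fin fout (s (e k).1) (s (e k).2) (nndist (x (e k).1) (x (e k).2))}
  have hA : ∀ s, MeasurableSet (A s) := fun s => by
    simp only [A, Set.ofPred_forall]
    exact MeasurableSet.iInter fun i => hG.labels.measurable _ (measurableSet_singleton _)
  have hD : ∀ s, MeasurableSet (D s) := fun s => by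
    simp only [D, Set.ofPred_forall]
    exact MeasurableSet.iInter fun k => measurableSet_le (hG.marks.measurable _) measurable_const
  have h1 : {ω | ∀ k, U (markIndex he hj k).1 ω ≤ edgeProb fin fout (Z (j (e k).1) ω)
      (Z (j (e k).2) ω) (nndist (x (e k).1) (x (e k).2))} = ⋃ s, A s ∩ D s := by
    ext ω
    simp only [Set.mem_iUnion, Set.mem_inter_iff, A, D, Set.mem_ofPred_eq]
    constructor
    · exact fun h => ⟨fun i => Z (j i) ω, fun i => rfl, h⟩
    · rintro ⟨s, hs, h⟩ k
      rw [hs, hs]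
      exact h k
  rw [h1, measure_iUnion (fun s s' hne => Set.disjoint_left.2 fun ω h h' => hne
    (funext fun i => (h.1 i).symm.trans (h'.1 i))) (fun s => (hA s).inter (hD s)), tsum_fintype]
  refine Finset.sum_congr rfl fun s _ => ?_
  have hind := hG.indep_labels_marks.measure_inter_preimage_eq_mul
    {z : ℕ → ℤˣ | ∀ i, z (j i) = s i}
    {u : MarkIndex → ℝ | ∀ k, u (markIndex he hj k) ≤
      edgeProb fin fout (s (e k).1) (s (e k).2) (nndist (x (e k).1) (x (e k).2))}
    (by
      simp only [Set.ofPred_forall]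
      exact MeasurableSet.iInter fun i => measurable_pi_apply (X := fun _ => ℤˣ) (j i)
        (measurableSet_singleton (s i)))
    (by
      simp only [Set.ofPred_forall]
      exact MeasurableSet.iInter fun k => measurableSet_le (measurable_pi_apply _)
        measurable_const)
  refine hind.trans (congrArg₂ (· * ·) (hG.labels.measure_forall_eq hj s) ?_)
  exact hG.marks.measure_forall_le (markIndex_injective he hj) (fun k => edgeProb_le_one hf _ _ _)

lemma measurable_edgeProb_comp {α : Type*} [MeasurableSpace α] {fin fout : ℝ≥0 → ℝ}
    (h1 : Measurable fin) (h2 : Measurable fout) {s t : α → ℤˣ} {r : α → ℝ≥0}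
    (hs : Measurable s) (ht : Measurable t) (hr : Measurable r) :
    Measurable fun a => edgeProb fin fout (s a) (t a) (r a) :=
  Measurable.ite (measurableSet_eq_fun hs ht) (h1.comp hr) (h2.comp hr)

lemma thresholdGraph_plantedProb_adj (fin fout : ℝ≥0 → ℝ) (x : ℕ → EuclideanSpace ℝ (Fin d))
    (z : ℕ → ℤˣ) (u : Sym2 ℕ → ℝ) (i j : ℕ) :
    (thresholdGraph u (plantedProb fin fout x z)).Adj i j ↔
      i ≠ j ∧ u s(i, j) ≤ edgeProb fin fout (z i) (z j) (nndist (x i) (x j)) :=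
  Iff.rfl

lemma thresholdGraph_connectionProb_adj (g : ℝ≥0 → ℝ) (x : ℕ → EuclideanSpace ℝ (Fin d))
    (u : Sym2 ℕ → ℝ) (i j : ℕ) :
    (thresholdGraph u (connectionProb g x)).Adj i j ↔
      i ≠ j ∧ u s(i, j) ≤ g (nndist (x i) (x j)) :=
  Iff.rfl

theorem IsPlantedPartitionData.hasEdgeLaw [IsProbabilityMeasure P]
    (hG : IsPlantedPartitionData P lam X Z U) {fin fout : ℝ≥0 → ℝ}
    (h1 : Measurable fin) (h2 : Measurable fout)
    (hf : ∀ r, 1 ≥ fin r ∧ fin r ≥ fout r ∧ fout r ≥ 0) :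
    HasEdgeLaw P X (fun ω => thresholdGraph (fun e => U e ω)
      (plantedProb fin fout (fun i => X i ω) (fun i => Z i ω))) fin fout where
  measurableSet_adj i j := by
    simp only [thresholdGraph_plantedProb_adj]
    exact (MeasurableSet.const _).inter (measurableSet_le (hG.marks.measurable _)
      (measurable_edgeProb_comp h1 h2 (hG.labels.measurable _) (hG.labels.measurable _)
        ((hG.points.measurable _).nndist (hG.points.measurable _))))
  edges {ι K} _ _ _ e he j hj C hC := by
    let D : Set ((ℕ → EuclideanSpace ℝ (Fin d)) × ((ℕ → ℤˣ) × (MarkIndex → ℝ))) :=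
      {q | q.1 ∈ C ∧ ∀ k, q.2.2 (markIndex he hj k) ≤ edgeProb fin fout (q.2.1 (j (e k).1))
        (q.2.1 (j (e k).2)) (nndist (q.1 (j (e k).1)) (q.1 (j (e k).2)))}
    have hD : MeasurableSet D := by
      have : D = {q | q.1 ∈ C} ∩ ⋂ k, {q | q.2.2 (markIndex he hj k) ≤
          edgeProb fin fout (q.2.1 (j (e k).1)) (q.2.1 (j (e k).2))
            (nndist (q.1 (j (e k).1)) (q.1 (j (e k).2)))} := by
        ext q; simp [D]
      rw [this]
      refine MeasurableSet.inter (measurable_fst hC) (MeasurableSet.iInter fun k => measurableSet_le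
        ((measurable_pi_apply _).comp (measurable_snd.comp measurable_snd))
        (measurable_edgeProb_comp h1 h2
          ((measurable_pi_apply _).comp (measurable_fst.comp measurable_snd))
          ((measurable_pi_apply _).comp (measurable_fst.comp measurable_snd)) ?_))
      exact ((measurable_pi_apply _).comp measurable_fst).nndist
        ((measurable_pi_apply _).comp measurable_fst)
    have hX : Measurable fun ω i => X i ω := measurable_pi_iff.2 hG.points.measurable
    have hM : Measurable fun ω => ((fun i : ℕ => Z i ω), fun e : MarkIndex => U e.1 ω) :=
      (measurable_pi_iff.2 hG.labels.measurable).prodMk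
        (measurable_pi_iff.2 fun e => hG.marks.measurable e.1)
    have h3 := measure_prodMk_mem_of_indepFun hX hM hG.indep_points hD
    have h4 : {ω | (fun i => X i ω) ∈ C ∧ ∀ k, (thresholdGraph (fun e => U e ω)
        (plantedProb fin fout (fun i => X i ω) (fun i => Z i ω))).Adj (j (e k).1) (j (e k).2)} =
        {ω | ((fun i => X i ω), ((fun i : ℕ => Z i ω), fun e : MarkIndex => U e.1 ω)) ∈ D} := by
      ext ω
      -- The clause `i ≠ j` in adjacency holds automatically, `j` being injective on distinct
      -- endpoints.
      exact and_congr_right fun _ => forall_congr' fun k =>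
        and_iff_right (hj.ne (he.1 k))
    have hXC : MeasurableSet {ω | (fun i => X i ω) ∈ C} := hX hC
    rw [h4, h3, ← lintegral_indicator hXC]
    refine lintegral_congr fun ω => ?_
    by_cases hω : (fun i => X i ω) ∈ C
    · rw [Set.indicator_of_mem (s := {ω | (fun i => X i ω) ∈ C}) hω,
        ← hG.measure_forall_le hf he hj]
      congr 1
      ext ω'
      exact and_iff_right hω
    · rw [Set.indicator_of_notMem (s := {ω | (fun i => X i ω) ∈ C}) hω]
      refine measure_mono_null (fun ω' h => hω h.1) measure_empty

/-- With equal connection functions the labels average out, so the random connection model falls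
under the same `HasEdgeLaw` as the planted one. -/
lemma edgeWeight_self (g : ℝ≥0 → ℝ) {ι K : Type} [Fintype ι] [DecidableEq ι] [Fintype K]
    (e : K → ι × ι) (x : ι → EuclideanSpace ℝ (Fin d)) :
    edgeWeight g g e x = ∏ k, ENNReal.ofReal (g (nndist (x (e k).1) (x (e k).2))) := by
  have h : Fintype.card ℤˣ = 2 := by decide
  simp only [edgeWeight, edgeProb, ite_self, Finset.sum_const, Finset.card_univ, Fintype.card_fun,
    h, nsmul_eq_mul, ← mul_assoc]
  rw [Nat.cast_pow, ← mul_pow]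
  simp [ENNReal.mul_inv_cancel]

theorem IsConnectionData.hasEdgeLaw [IsProbabilityMeasure P]
    (hH : IsConnectionData P lam X U) {g : ℝ≥0 → ℝ} (hg : Measurable g)
    (hg' : ∀ r, g r ∈ Set.Icc (0 : ℝ) 1) :
    HasEdgeLaw P X (fun ω => thresholdGraph (fun e => U e ω)
      (connectionProb g (fun i => X i ω))) g g where
  measurableSet_adj i j := by
    simp only [thresholdGraph_connectionProb_adj]
    exact (MeasurableSet.const _).inter (measurableSet_le (hH.marks.measurable _)
      (hg.comp ((hH.points.measurable _).nndist (hH.points.measurable _))))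
  edges {ι K} _ _ _ e he j hj C hC := by
    let D : Set ((ℕ → EuclideanSpace ℝ (Fin d)) × (MarkIndex → ℝ)) :=
      {q | q.1 ∈ C ∧ ∀ k, q.2 (markIndex he hj k) ≤
        g (nndist (q.1 (j (e k).1)) (q.1 (j (e k).2)))}
    have hD : MeasurableSet D := by
      have : D = {q | q.1 ∈ C} ∩ ⋂ k, {q | q.2 (markIndex he hj k) ≤
          g (nndist (q.1 (j (e k).1)) (q.1 (j (e k).2)))} := by
        ext q; simp [D]
      rw [this]
      refine MeasurableSet.inter (measurable_fst hC) (MeasurableSet.iInter fun k => measurableSet_le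
        ((measurable_pi_apply _).comp measurable_snd) (hg.comp ?_))
      exact ((measurable_pi_apply _).comp measurable_fst).nndist
        ((measurable_pi_apply _).comp measurable_fst)
    have hX : Measurable fun ω i => X i ω := measurable_pi_iff.2 hH.points.measurable
    have hM : Measurable fun ω => fun e : MarkIndex => U e.1 ω :=
      measurable_pi_iff.2 fun e => hH.marks.measurable e.1
    have h3 := measure_prodMk_mem_of_indepFun hX hM hH.indep_points hD
    have h4 : {ω | (fun i => X i ω) ∈ C ∧ ∀ k, (thresholdGraph (fun e => U e ω)
        (connectionProb g (fun i => X i ω))).Adj (j (e k).1) (j (e k).2)} =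
        {ω | ((fun i => X i ω), fun e : MarkIndex => U e.1 ω) ∈ D} := by
      ext ω
      exact and_congr_right fun _ => forall_congr' fun k =>
        and_iff_right (hj.ne (he.1 k))
    have hXC : MeasurableSet {ω | (fun i => X i ω) ∈ C} := hX hC
    rw [h4, h3, ← lintegral_indicator hXC]
    refine lintegral_congr fun ω => ?_
    by_cases hω : (fun i => X i ω) ∈ C
    · rw [Set.indicator_of_mem (s := {ω | (fun i => X i ω) ∈ C}) hω, edgeWeight_self,
        ← hH.marks.measure_forall_le (markIndex_injective he hj) (fun k => (hg' _).2)]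
      congr 1
      ext ω'
      exact and_iff_right hω
    · rw [Set.indicator_of_notMem (s := {ω | (fun i => X i ω) ∈ C}) hω]
      refine measure_mono_null (fun ω' h => hω h.1) measure_empty

end SpatialPlantedPartition

namespace SpatialPlantedPartition

/-! ### Frequencies of pairwise independent events -/

section Frequencies

open Filter Topology

variable {α : Type*} [MeasurableSpace α] {μ ν : Measure α} [IsProbabilityMeasure μ]
  [IsProbabilityMeasure ν] {A : ℕ → Set α}

/-- This form of the strong law needs only pairwise independence, so intersections of two events are
enough. -/
lemma ae_tendsto_frequency (hA : ∀ k, MeasurableSet (A k)) {p : ℝ≥0∞} (h1 : ∀ k, μ (A k) = p)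
    (h2 : ∀ k l, k ≠ l → μ (A k ∩ A l) = p * p) :
    ∀ᵐ a ∂μ, Tendsto (fun n : ℕ =>
      (∑ k ∈ Finset.range n, (A k).indicator (fun _ => (1 : ℝ)) a) / n) atTop (𝓝 p.toReal) := by
  have hm : ∀ k, Measurable ((A k).indicator fun _ => (1 : ℝ)) := fun k =>
    measurable_const.indicator (hA k)
  have h := strong_law_ae_real (μ := μ) (fun k => (A k).indicator fun _ => (1 : ℝ))
    ((integrable_const 1).indicator (hA 0)) ?_ ?_
  · have h0 : ∫ a, (A 0).indicator (fun _ => (1 : ℝ)) a ∂μ = p.toReal := by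
      rw [integral_indicator_const _ (hA 0), measureReal_def, h1, smul_eq_mul, mul_one]
    rwa [h0] at h
  · intro k l hkl
    have hs : IndepSet (A k) (A l) μ := (indepSet_iff_measure_inter_eq_mul (hA k) (hA l) μ).2
      (by rw [h2 k l hkl, h1, h1])
    -- An indicator is measurable for the σ-algebra generated by its set, so independence passes
    -- from events to indicators.
    have hc : ∀ k, MeasurableSpace.comap ((A k).indicator fun _ => (1 : ℝ)) inferInstance ≤
        MeasurableSpace.generateFrom {A k} := fun k =>
      Measurable.comap_le (m₁ := MeasurableSpace.generateFrom {A k})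
        (measurable_const.indicator (MeasurableSpace.measurableSet_generateFrom rfl))
    exact indep_of_indep_of_le_left (indep_of_indep_of_le_right hs (hc l)) (hc k)
  · intro k
    refine ⟨(hm k).aemeasurable, (hm 0).aemeasurable, Measure.ext fun s hs => ?_⟩
    classical
    -- A preimage under the indicator is a union of some of `A k` and its complement, so the common
    -- value of `μ (A k)` fixes the distribution.
    rw [Measure.map_apply (hm k) hs, Measure.map_apply (hm 0) hs,
      Set.indicator_const_preimage_eq_union, Set.indicator_const_preimage_eq_union]
    have hc : μ (A k)ᶜ = μ (A 0)ᶜ := by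
      rw [measure_compl (hA k) (measure_ne_top _ _), measure_compl (hA 0) (measure_ne_top _ _),
        h1, h1]
    split_ifs <;> simp [h1, hc]

/-- A frequency has at most one limit, so the two null sets of failed convergence cover the space.
-/
lemma mutuallySingular_of_frequency (hA : ∀ k, MeasurableSet (A k)) {p q : ℝ≥0∞} (hpq : p ≠ q)
    (h1 : ∀ k, μ (A k) = p) (h2 : ∀ k l, k ≠ l → μ (A k ∩ A l) = p * p)
    (h3 : ∀ k, ν (A k) = q) (h4 : ∀ k l, k ≠ l → ν (A k ∩ A l) = q * q) :
    μ ⟂ₘ ν := by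
  refine Measure.MutuallySingular.mk (ae_iff.1 (ae_tendsto_frequency hA h1 h2))
    (ae_iff.1 (ae_tendsto_frequency hA h3 h4)) fun a _ => ?_
  by_contra h
  simp only [Set.mem_union, Set.mem_ofPred_eq, not_or, not_not] at h
  have hp : p ≠ ∞ := h1 0 ▸ measure_ne_top _ _
  have hq : q ≠ ∞ := h3 0 ▸ measure_ne_top _ _
  exact hpq ((ENNReal.toReal_eq_toReal_iff' hp hq).1 (tendsto_nhds_unique h.1 h.2))

end Frequencies

/-! ### Translates and disjoint unions of patterns -/

variable {d : ℕ}

/-- The translate of `B` by `v`. -/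
def translate (v : EuclideanSpace ℝ (Fin d)) (B : Set (EuclideanSpace ℝ (Fin d))) :
    Set (EuclideanSpace ℝ (Fin d)) :=
  (fun x => x - v) ⁻¹' B

lemma measurableSet_translate (v : EuclideanSpace ℝ (Fin d))
    {B : Set (EuclideanSpace ℝ (Fin d))} (hB : MeasurableSet B) :
    MeasurableSet (translate v B) :=
  (measurable_id.sub_const v) hB

lemma isBounded_translate (v : EuclideanSpace ℝ (Fin d))
    {B : Set (EuclideanSpace ℝ (Fin d))} (hb : Bornology.IsBounded B) :
    Bornology.IsBounded (translate v B) := by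
  obtain ⟨R, hR⟩ := hb.subset_closedBall 0
  refine (Metric.isBounded_closedBall (x := v) (r := R)).subset fun x hx => ?_
  have := hR hx
  rwa [mem_closedBall_zero_iff, ← dist_eq_norm] at this

lemma measurePreserving_boxMeasure_translate (lam : ℝ≥0) (v : EuclideanSpace ℝ (Fin d))
    {B : Set (EuclideanSpace ℝ (Fin d))} (hB : MeasurableSet B) :
    MeasurePreserving (fun x => x + v) (boxMeasure lam B) (boxMeasure lam (translate v B)) := by
  have h1 : (fun x => x + v) ⁻¹' translate v B = B := by
    ext x; simp [translate]
  have h2 : volume (translate v B) = volume B := by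
    have := (measurePreserving_add_right volume v).measure_preimage
      (measurableSet_translate v hB).nullMeasurableSet
    rw [h1] at this
    exact this.symm
  have h3 := (measurePreserving_add_right volume v).restrict_preimage
    (measurableSet_translate v hB)
  rw [h1] at h3
  rw [boxMeasure, boxMeasure, h2]
  exact h3.smul_measure _

variable {ι ι' K K' : Type} [Fintype ι] [DecidableEq ι] [Fintype K] [Fintype ι'] [DecidableEq ι']
  [Fintype K'] {fin fout : ℝ≥0 → ℝ} {lam : ℝ≥0}

lemma edgeWeight_translate (e : K → ι × ι) (v : EuclideanSpace ℝ (Fin d))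
    (x : ι → EuclideanSpace ℝ (Fin d)) :
    edgeWeight fin fout e (fun i => x i + v) = edgeWeight fin fout e x := by
  simp [edgeWeight]

lemma lintegral_edgeWeight_translate (h1 : Measurable fin) (h2 : Measurable fout)
    (e : K → ι × ι) (v : EuclideanSpace ℝ (Fin d)) {B : ι → Set (EuclideanSpace ℝ (Fin d))}
    (hB : ∀ i, MeasurableSet (B i)) (hb : ∀ i, Bornology.IsBounded (B i)) :
    ∫⁻ x, edgeWeight fin fout e x ∂Measure.pi (fun i => boxMeasure lam (translate v (B i))) =
      ∫⁻ x, edgeWeight fin fout e x ∂Measure.pi fun i => boxMeasure lam (B i) := by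
  have := fun i => isFiniteMeasure_boxMeasure lam (isBounded_translate v (hb i))
  rw [← (measurePreserving_pi _ _ fun i =>
    measurePreserving_boxMeasure_translate lam v (hB i)).lintegral_comp
      (measurable_edgeWeight h1 h2 e)]
  simp only [edgeWeight_translate]

/-- The disjoint union of two families of edges. -/
def sumEdges {ι ι' K K' : Type} (e : K → ι × ι) (e' : K' → ι' × ι') :
    K ⊕ K' → (ι ⊕ ι') × (ι ⊕ ι') :=
  Sum.elim (fun k => (.inl (e k).1, .inl (e k).2)) fun k => (.inr (e' k).1, .inr (e' k).2)

lemma isEdgeFamily_sumEdges {ι ι' K K' : Type} {e : K → ι × ι} {e' : K' → ι' × ι'}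
    (he : IsEdgeFamily e) (he' : IsEdgeFamily e') : IsEdgeFamily (sumEdges e e') := by
  constructor
  · rintro (k | k)
    · simpa [sumEdges] using he.1 k
    · simpa [sumEdges] using he'.1 k
  · rintro (k | k) (l | l) h
    · simp only [sumEdges, Sum.elim_inl, Sym2.eq_iff, Sum.inl.injEq] at h
      rw [he.2 (Sym2.eq_iff.2 h)]
    · simp [sumEdges] at h
    · simp [sumEdges] at h
    · simp only [sumEdges, Sum.elim_inr, Sym2.eq_iff, Sum.inr.injEq] at h
      rw [he'.2 (Sym2.eq_iff.2 h)]

/-- No edge joins the two halves, so the sum over labellings of the union factors. -/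
lemma edgeWeight_sumEdges (e : K → ι × ι) (e' : K' → ι' × ι')
    (x : ι ⊕ ι' → EuclideanSpace ℝ (Fin d)) :
    edgeWeight fin fout (sumEdges e e') x =
      edgeWeight fin fout e (fun i => x (.inl i)) *
        edgeWeight fin fout e' fun i => x (.inr i) := by
  simp only [edgeWeight]
  rw [Finset.sum_mul_sum, ← Fintype.sum_prod_type']
  refine Fintype.sum_equiv (Equiv.sumArrowEquivProdArrow ι ι' ℤˣ) _ _ fun s => ?_
  rw [Fintype.prod_sum_type, Fintype.card_sum, pow_add, mul_mul_mul_comm]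
  rfl

lemma lintegral_edgeWeight_sumEdges (h1 : Measurable fin) (h2 : Measurable fout)
    (e : K → ι × ι) (e' : K' → ι' × ι') (B : ι ⊕ ι' → Set (EuclideanSpace ℝ (Fin d)))
    (hb : ∀ i, Bornology.IsBounded (B i)) :
    ∫⁻ x, edgeWeight fin fout (sumEdges e e') x ∂Measure.pi (fun i => boxMeasure lam (B i)) =
      (∫⁻ x, edgeWeight fin fout e x ∂Measure.pi fun i => boxMeasure lam (B (.inl i))) *
        ∫⁻ x, edgeWeight fin fout e' x ∂Measure.pi fun i => boxMeasure lam (B (.inr i)) := by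
  have := fun i => isFiniteMeasure_boxMeasure lam (hb i)
  have h := (measurePreserving_sumPiEquivProdPi (X := fun _ => EuclideanSpace ℝ (Fin d))
    fun i => boxMeasure lam (B i)).lintegral_comp
    (f := fun z => edgeWeight fin fout e z.1 * edgeWeight fin fout e' z.2)
    (((measurable_edgeWeight h1 h2 e).comp measurable_fst).mul
      ((measurable_edgeWeight h1 h2 e').comp measurable_snd))
  rw [lintegral_prod_mul (measurable_edgeWeight h1 h2 e).aemeasurable
    (measurable_edgeWeight h1 h2 e').aemeasurable] at h
  rw [← h]
  exact lintegral_congr fun x => edgeWeight_sumEdges e e' x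

lemma patternEvent_sumEdges {ι ι' K K' : Type} (e : K → ι × ι) (e' : K' → ι' × ι')
    (B : ι ⊕ ι' → Set (EuclideanSpace ℝ (Fin d))) :
    patternEvent (sumEdges e e') B =
      patternEvent e (fun i => B (.inl i)) ∩ patternEvent e' fun i => B (.inr i) := by
  ext S
  simp only [patternEvent, sumEdges, Set.mem_inter_iff, Set.mem_ofPred_eq, Sum.forall,
    Sum.elim_inl, Sum.elim_inr]
  tauto

/-- Bounded sets have translates that are far apart from each other. -/
lemma exists_translations (hd : 1 ≤ d) {ι : Type} [Finite ι]
    {B : ι → Set (EuclideanSpace ℝ (Fin d))}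
    (hb : ∀ i, Bornology.IsBounded (B i)) :
    ∃ v : ℕ → EuclideanSpace ℝ (Fin d), ∀ k l, k ≠ l → ∀ i j,
      Disjoint (translate (v k) (B i)) (translate (v l) (B j)) := by
  obtain ⟨R, hR⟩ := (Bornology.isBounded_iUnion.2 hb).subset_closedBall 0
  have hR' : ∀ i, ∀ x ∈ B i, ‖x‖ ≤ |R| := fun i x hx =>
    (mem_closedBall_zero_iff.1 (hR (Set.mem_iUnion.2 ⟨i, hx⟩))).trans (le_abs_self R)
  let u : EuclideanSpace ℝ (Fin d) := EuclideanSpace.single ⟨0, hd⟩ 1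
  have hu : ‖u‖ = 1 := by simp [u]
  -- All boxes lie in a ball of radius `|R|`, so a spacing larger than its diameter `2 * |R|`
  -- separates the translates.
  refine ⟨fun k => ((k : ℝ) * (2 * |R| + 1)) • u, fun k l hkl i j =>
    Set.disjoint_left.2 fun x hx hx' => ?_⟩
  have h1 := hR' _ _ hx
  have h2 := hR' _ _ hx'
  have h3 : ‖((k : ℝ) * (2 * |R| + 1)) • u - ((l : ℝ) * (2 * |R| + 1)) • u‖ ≤ |R| + |R| := by
    refine le_trans ?_ (add_le_add h2 h1)
    rw [← sub_sub_sub_cancel_left _ _ x]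
    exact norm_sub_le _ _
  rw [← sub_smul, norm_smul, hu, mul_one, ← sub_mul, norm_mul, Real.norm_eq_abs,
    Real.norm_eq_abs, abs_of_pos (by positivity : 0 < 2 * |R| + 1)] at h3
  have h4 : (1 : ℝ) ≤ |(k : ℝ) - l| := by
    have : (1 : ℤ) ≤ |(k : ℤ) - l| := Int.one_le_abs (by omega)
    exact_mod_cast this
  nlinarith [abs_nonneg R]

variable {Ω Ω' : Type*} [MeasurableSpace Ω] [MeasurableSpace Ω'] {P : Measure Ω}
  {P' : Measure Ω'}
  {X : ℕ → Ω → EuclideanSpace ℝ (Fin d)} {X' : ℕ → Ω' → EuclideanSpace ℝ (Fin d)}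
  {Γ : Ω → SimpleGraph ℕ} {Γ' : Ω' → SimpleGraph ℕ} {fin' fout' : ℝ≥0 → ℝ}

/-- Two separated translates form one pattern on `ι ⊕ ι`, whose probability factors. -/
lemma map_patternEvent_inter (hX : IsPoissonProcess P lam X) (h1 : Measurable fin)
    (h2 : Measurable fout) (hΓ : HasEdgeLaw P X Γ fin fout) {e : K → ι × ι}
    (he : IsEdgeFamily e) {B : ι → Set (EuclideanSpace ℝ (Fin d))}
    (hB : ∀ i, MeasurableSet (B i)) (hb : ∀ i, Bornology.IsBounded (B i))
    (hdisj : Pairwise (Function.onFun Disjoint B)) {v w : EuclideanSpace ℝ (Fin d)}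
    (hvw : ∀ i j, Disjoint (translate v (B i)) (translate w (B j))) :
    P.map (randomGraph X Γ) (patternEvent e (fun i => translate v (B i)) ∩
        patternEvent e fun i => translate w (B i)) =
      (∫⁻ x, edgeWeight fin fout e x ∂Measure.pi fun i => boxMeasure lam (B i)) *
        ∫⁻ x, edgeWeight fin fout e x ∂Measure.pi fun i => boxMeasure lam (B i) := by
  let D : ι ⊕ ι → Set (EuclideanSpace ℝ (Fin d)) :=
    Sum.elim (fun i => translate v (B i)) fun i => translate w (B i)
  have hDm : ∀ i, MeasurableSet (D i) := by
    rintro (i | i) <;> exact measurableSet_translate _ (hB i)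
  have hDb : ∀ i, Bornology.IsBounded (D i) := by
    rintro (i | i) <;> exact isBounded_translate _ (hb i)
  have hDd : Pairwise (Function.onFun Disjoint D) := by
    rintro (i | i) (j | j) hij
    · exact (hdisj fun h => hij (congrArg _ h)).preimage _
    · exact hvw i j
    · exact (hvw j i).symm
    · exact (hdisj fun h => hij (congrArg _ h)).preimage _
  have h := map_randomGraph_patternEvent hX h1 h2 hΓ (isEdgeFamily_sumEdges he he) hDm hDb hDd
  rw [patternEvent_sumEdges, lintegral_edgeWeight_sumEdges h1 h2 e e D hDb] at h
  refine h.trans (congrArg₂ _ ?_ ?_)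
  · exact lintegral_edgeWeight_translate h1 h2 e v hB hb
  · exact lintegral_edgeWeight_translate h1 h2 e w hB hb

/-- Two random graphs with different pattern probabilities have mutually singular laws. -/
theorem mutuallySingular_of_lintegral_edgeWeight_ne [IsProbabilityMeasure P]
    [IsProbabilityMeasure P'] (hd : 1 ≤ d) (hX : IsPoissonProcess P lam X)
    (hX' : IsPoissonProcess P' lam X') (h1 : Measurable fin) (h2 : Measurable fout)
    (h1' : Measurable fin') (h2' : Measurable fout') (hΓ : HasEdgeLaw P X Γ fin fout)
    (hΓ' : HasEdgeLaw P' X' Γ' fin' fout') {e : K → ι × ι} (he : IsEdgeFamily e)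
    {B : ι → Set (EuclideanSpace ℝ (Fin d))}
    (hB : ∀ i, MeasurableSet (B i)) (hb : ∀ i, Bornology.IsBounded (B i))
    (hdisj : Pairwise (Function.onFun Disjoint B))
    (hne : ∫⁻ x, edgeWeight fin fout e x ∂Measure.pi (fun i => boxMeasure lam (B i)) ≠
      ∫⁻ x, edgeWeight fin' fout' e x ∂Measure.pi fun i => boxMeasure lam (B i)) :
    P.map (randomGraph X Γ) ⟂ₘ P'.map (randomGraph X' Γ') := by
  have hp := Measure.isProbabilityMeasure_map (aemeasurable_randomGraph hX hΓ.measurableSet_adj)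
  have hp' := Measure.isProbabilityMeasure_map
    (aemeasurable_randomGraph hX' hΓ'.measurableSet_adj)
  obtain ⟨v, hv⟩ := exists_translations hd hb
  have hm : ∀ k i, MeasurableSet (translate (v k) (B i)) := fun k i =>
    measurableSet_translate _ (hB i)
  have hbd : ∀ k i, Bornology.IsBounded (translate (v k) (B i)) := fun k i =>
    isBounded_translate _ (hb i)
  have hdd : ∀ k, Pairwise (Function.onFun Disjoint fun i => translate (v k) (B i)) :=
    fun k i j hij => (hdisj hij).preimage _
  refine mutuallySingular_of_frequency
    (A := fun k => patternEvent e fun i => translate (v k) (B i))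
    (fun k => measurableSet_patternEvent e (hm k)) hne (fun k => ?_)
    (fun k l hkl => map_patternEvent_inter hX h1 h2 hΓ he hB hb hdisj (hv k l hkl)) (fun k => ?_)
    (fun k l hkl => map_patternEvent_inter hX' h1' h2' hΓ' he hB hb hdisj (hv k l hkl))
  · rw [map_randomGraph_patternEvent hX h1 h2 hΓ he (hm k) (hbd k) (hdd k),
      lintegral_edgeWeight_translate h1 h2 e (v k) hB hb]
  · rw [map_randomGraph_patternEvent hX' h1' h2' hΓ' he (hm k) (hbd k) (hdd k),
      lintegral_edgeWeight_translate h1' h2' e (v k) hB hb]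

end SpatialPlantedPartition

namespace SpatialPlantedPartition

/-! ### Patterns in disjoint boxes determine the edge weights -/

section Determination

variable {d : ℕ} {ι : Type} [Fintype ι]

lemma pi_boxMeasure {lam : ℝ≥0} (B : ι → Set (EuclideanSpace ℝ (Fin d)))
    (hb : ∀ i, Bornology.IsBounded (B i)) :
    Measure.pi (fun i => boxMeasure lam (B i)) =
      (∏ i, ENNReal.ofReal (lam * Real.exp (-(lam * (volume (B i)).toReal)))) •
        volume.restrict (Set.univ.pi B) := by
  have := fun i => isFiniteMeasure_boxMeasure lam (hb i)
  refine Measure.pi_eq fun s hs => ?_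
  rw [volume_pi, Measure.restrict_pi_pi, Measure.smul_apply, Measure.pi_pi, smul_eq_mul,
    ← Finset.prod_mul_distrib]
  rfl

/-- Rectangles form a π-system generating the product σ-algebra, so finite measures with densities
`f` and `g` that agree on rectangles coincide. The bound on `f` gives finiteness. -/
lemma ae_restrict_eq_of_setLIntegral_pi_eq {B : ι → Set (EuclideanSpace ℝ (Fin d))}
    (hb : ∀ i, Bornology.IsBounded (B i))
    {f g : (ι → EuclideanSpace ℝ (Fin d)) → ℝ≥0∞} (hf : Measurable f) (hg : Measurable g)
    (hf1 : ∀ x, f x ≤ 1)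
    (h : ∀ A : ι → Set (EuclideanSpace ℝ (Fin d)), (∀ i, MeasurableSet (A i)) →
      ∫⁻ x in Set.univ.pi (fun i => A i ∩ B i), f x =
        ∫⁻ x in Set.univ.pi (fun i => A i ∩ B i), g x) :
    f =ᵐ[volume.restrict (Set.univ.pi B)] g := by
  have hfin : volume (Set.univ.pi B) < ∞ := by
    rw [volume_pi_pi]
    exact ENNReal.prod_lt_top fun i _ => (hb i).measure_lt_top
  have hint : ∫⁻ x in Set.univ.pi B, f x ≠ ∞ := by
    refine ne_top_of_le_ne_top hfin.ne ((lintegral_mono hf1).trans ?_)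
    simp
  have hrect : ∀ A : ι → Set (EuclideanSpace ℝ (Fin d)), (∀ i, MeasurableSet (A i)) →
      (volume.restrict (Set.univ.pi B)).withDensity f (Set.univ.pi A) =
        (volume.restrict (Set.univ.pi B)).withDensity g (Set.univ.pi A) := fun A hA => by
    rw [withDensity_apply _ (MeasurableSet.univ_pi hA),
      withDensity_apply _ (MeasurableSet.univ_pi hA),
      Measure.restrict_restrict (MeasurableSet.univ_pi hA), ← Set.pi_inter_distrib]
    exact h A hA
  have huniv : (Set.univ : Set (ι → EuclideanSpace ℝ (Fin d))) =
      Set.univ.pi fun _ => Set.univ := (Set.pi_univ _).symm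
  have : IsFiniteMeasure ((volume.restrict (Set.univ.pi B)).withDensity f) :=
    isFiniteMeasure_withDensity hint
  refine (withDensity_eq_iff hf.aemeasurable hg.aemeasurable hint).1
    (ext_of_generate_finite _ generateFrom_pi.symm isPiSystem_pi ?_ ?_)
  · rintro _ ⟨A, hA, rfl⟩
    exact hrect A fun i => hA i trivial
  · rw [huniv]
    exact hrect _ fun _ => MeasurableSet.univ

lemma ae_injective (hd : 1 ≤ d) :
    ∀ᵐ x : ι → EuclideanSpace ℝ (Fin d), Function.Injective x := by
  have h : ∀ᵐ x : ι → EuclideanSpace ℝ (Fin d), ∀ i j, i ≠ j → x i ≠ x j := by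
    refine ae_all_iff.2 fun i => ae_all_iff.2 fun j => ae_all_iff.2 fun hij => ?_
    classical
    let s : Submodule ℝ (ι → EuclideanSpace ℝ (Fin d)) := LinearMap.ker
      (LinearMap.proj (R := ℝ) (φ := fun _ : ι => EuclideanSpace ℝ (Fin d)) i -
        LinearMap.proj j)
    have hs : s ≠ ⊤ := by
      intro htop
      have : Pi.single i (EuclideanSpace.single ⟨0, hd⟩ (1 : ℝ)) ∈ s := htop ▸ trivial
      simp [s, hij.symm] at this
    have h0 := Measure.addHaar_submodule volume s hs
    rw [ae_iff]
    refine measure_mono_null (fun x hx => ?_) h0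
    simp only [ne_eq, not_not, Set.mem_ofPred_eq] at hx
    simp [s, hx]
  filter_upwards [h] with x hx i j hij
  by_contra hne
  exact hx i j hne hij

/-- Almost every configuration has distinct points, and such a configuration lies in a product of
disjoint balls taken from a countable family; hence a countable union of null sets suffices. -/
lemma ae_of_forall_disjoint (hd : 1 ≤ d) {p : (ι → EuclideanSpace ℝ (Fin d)) → Prop}
    (h : ∀ B : ι → Set (EuclideanSpace ℝ (Fin d)), (∀ i, MeasurableSet (B i)) →
      (∀ i, Bornology.IsBounded (B i)) → Pairwise (Function.onFun Disjoint B) →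
      ∀ᵐ x, x ∈ Set.univ.pi B → p x) :
    ∀ᵐ x, p x := by
  let u := TopologicalSpace.denseSeq (EuclideanSpace ℝ (Fin d))
  let B : ℕ → (ι → ℕ) → ι → Set (EuclideanSpace ℝ (Fin d)) :=
    fun n q i => Metric.ball (u (q i)) (1 / ((n : ℝ) + 1))
  have h1 : ∀ᵐ x : ι → EuclideanSpace ℝ (Fin d), ∀ n q,
      Pairwise (Function.onFun Disjoint (B n q)) → x ∈ Set.univ.pi (B n q) → p x := by
    refine ae_all_iff.2 fun n => ae_all_iff.2 fun q => ae_all_iff.2 fun hdisj => ?_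
    exact h _ (fun i => measurableSet_ball) (fun i => Metric.isBounded_ball) hdisj
  filter_upwards [h1, ae_injective hd] with x hx hinj
  -- With points more than four radii apart and each centre within one radius of its point, the
  -- centres are more than two radii apart.
  have h2 : ∀ᶠ n : ℕ in Filter.atTop, ∀ i j, i ≠ j →
      4 * (1 / ((n : ℝ) + 1)) < dist (x i) (x j) := by
    refine Filter.eventually_all.2 fun i => Filter.eventually_all.2 fun j => ?_
    by_cases hij : i = j
    · exact Filter.Eventually.of_forall fun n h => absurd hij h
    · have := (tendsto_one_div_add_atTop_nhds_zero_nat (𝕜 := ℝ)).const_mul 4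
      rw [mul_zero] at this
      filter_upwards [this.eventually_lt_const (dist_pos.2 (hinj.ne hij))] with n hn _ using hn
  obtain ⟨n, hn⟩ := h2.exists
  have hpos : 0 < 1 / ((n : ℝ) + 1) := by positivity
  have h3 : ∀ i, ∃ q, dist (x i) (u q) < 1 / ((n : ℝ) + 1) := fun i =>
    (TopologicalSpace.denseRange_denseSeq _).exists_dist_lt (x i) hpos
  choose q hq using h3
  refine hx n q (fun i j hij => Metric.ball_disjoint_ball ?_) fun i _ => hq i
  have h4 := dist_triangle4 (x i) (u (q i)) (u (q j)) (x j)
  have h5 := hq i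
  have h6 := hq j
  have h7 := hn i j hij
  rw [dist_comm (u (q j))] at h4
  linarith

lemma ae_edgeWeight_eq [DecidableEq ι] {K : Type} [Fintype K] (hd : 1 ≤ d) {lam : ℝ≥0}
    (hlam : 0 < lam) {fin fout fin' fout' : ℝ≥0 → ℝ} (h1 : Measurable fin) (h2 : Measurable fout)
    (h1' : Measurable fin') (h2' : Measurable fout') (e : K → ι × ι)
    (hle : ∀ x : ι → EuclideanSpace ℝ (Fin d), edgeWeight fin fout e x ≤ 1)
    (h : ∀ B : ι → Set (EuclideanSpace ℝ (Fin d)), (∀ i, MeasurableSet (B i)) →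
      (∀ i, Bornology.IsBounded (B i)) → Pairwise (Function.onFun Disjoint B) →
      ∫⁻ x, edgeWeight fin fout e x ∂Measure.pi (fun i => boxMeasure lam (B i)) =
        ∫⁻ x, edgeWeight fin' fout' e x ∂Measure.pi fun i => boxMeasure lam (B i)) :
    ∀ᵐ x : ι → EuclideanSpace ℝ (Fin d),
      edgeWeight fin fout e x = edgeWeight fin' fout' e x := by
  refine ae_of_forall_disjoint hd fun B hB hb hdisj => ?_
  refine (ae_restrict_iff' (MeasurableSet.univ_pi hB)).1 ?_
  refine ae_restrict_eq_of_setLIntegral_pi_eq hb (measurable_edgeWeight h1 h2 e)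
    (measurable_edgeWeight h1' h2' e) hle fun A hA => ?_
  -- Boxes shrunk to `A i ∩ B i` remain bounded and disjoint, so the hypothesis tests every
  -- rectangle.
  have hb' : ∀ i, Bornology.IsBounded (A i ∩ B i) := fun i => (hb i).subset Set.inter_subset_right
  have h3 := h (fun i => A i ∩ B i) (fun i => (hA i).inter (hB i)) hb'
    fun i j hij => (hdisj hij).mono Set.inter_subset_right Set.inter_subset_right
  rw [pi_boxMeasure _ hb', lintegral_smul_measure, lintegral_smul_measure, smul_eq_mul,
    smul_eq_mul] at h3
  -- The Poisson prefactor is finite, and nonzero because `lam` is positive, so it cancels.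
  refine (ENNReal.mul_right_inj ?_ ?_).1 h3
  · rw [Finset.prod_ne_zero_iff]
    intro i _
    have : (0 : ℝ) < lam := hlam
    simp only [ne_eq, ENNReal.ofReal_eq_zero, not_le]
    positivity
  · exact ENNReal.prod_ne_top fun i _ => ENNReal.ofReal_ne_top

end Determination

/-! ### Four-cycles -/

section FourCycle

variable {d : ℕ}

/-- In polar coordinates, a null set of such `x` makes the integral of `y ^ (d - 1)` over the
distances vanish, and the weight is positive for `y > 0`. -/
lemma volume_nnnorm_preimage_ne_zero (hd : 1 ≤ d) {S : Set ℝ≥0}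
    (hS : 0 < volume ((fun r : ℝ≥0 => (r : ℝ)) '' S)) :
    volume {x : EuclideanSpace ℝ (Fin d) | ‖x‖₊ ∈ S} ≠ 0 := by
  intro h0
  have : Nonempty (Fin d) := ⟨⟨0, hd⟩⟩
  set T : Set ℝ := (fun r : ℝ≥0 => (r : ℝ)) '' S
  let f : ℝ → ℝ := T.indicator fun _ => 1
  have hf : (fun x : EuclideanSpace ℝ (Fin d) => f ‖x‖) =ᵐ[volume] 0 := by
    rw [Filter.EventuallyEq, ae_iff]
    refine measure_mono_null (fun x hx => ?_) h0
    by_contra hxS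
    refine hx (Set.indicator_of_notMem ?_ _)
    rintro ⟨r, hr, hrx⟩
    have hrx' : r = ‖x‖₊ := NNReal.eq hrx
    exact hxS (show ‖x‖₊ ∈ S from hrx' ▸ hr)
  -- Integrability is inherited from the zero function, so `S` need not be measurable here.
  have hint := (integrable_fun_norm_addHaar (volume : Measure (EuclideanSpace ℝ (Fin d)))).1
    ((integrable_zero _ _ _).congr hf.symm)
  have heq := integral_fun_norm_addHaar (volume : Measure (EuclideanSpace ℝ (Fin d))) f
  rw [integral_congr_ae hf] at heq
  have hball : volume.real (Metric.ball (0 : EuclideanSpace ℝ (Fin d)) 1) ≠ 0 :=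
    (measureReal_ne_zero_iff measure_ball_lt_top.ne).2 (Metric.measure_ball_pos _ _ one_pos).ne'
  have hzero : ∫ y in Set.Ioi (0 : ℝ),
      y ^ (Module.finrank ℝ (EuclideanSpace ℝ (Fin d)) - 1) • f y = 0 := by
    have hd' : d ≠ 0 := by omega
    simpa [hball, hd'] using heq.symm
  have hnn : 0 ≤ᵐ[volume.restrict (Set.Ioi (0 : ℝ))] fun y =>
      y ^ (Module.finrank ℝ (EuclideanSpace ℝ (Fin d)) - 1) • f y := by
    filter_upwards [ae_restrict_mem measurableSet_Ioi] with y hy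
    exact mul_nonneg (pow_nonneg (le_of_lt hy) _) (Set.indicator_nonneg (fun _ _ => zero_le_one) _)
  have hae := (setIntegral_eq_zero_iff_of_nonneg_ae hnn hint).1 hzero
  have hae' := (ae_restrict_iff' measurableSet_Ioi).1 hae
  -- The radial statement covers only `y > 0`; the distance zero is added as a null set.
  refine hS.ne' (measure_mono_null (t := {y | ¬ (y ∈ Set.Ioi (0 : ℝ) →
    y ^ (Module.finrank ℝ (EuclideanSpace ℝ (Fin d)) - 1) • f y = (0 : ℝ → ℝ) y)} ∪ {0})
    (fun y hy => ?_) (measure_union_null (ae_iff.1 hae') (measure_singleton 0)))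
  obtain ⟨r, hr, rfl⟩ := id hy
  by_cases hr0 : (r : ℝ) = 0
  · exact Or.inr hr0
  · refine Or.inl fun h => ?_
    have hpos : (0 : ℝ) < r := lt_of_le_of_ne r.2 (Ne.symm hr0)
    have := h hpos
    simp only [f, Set.indicator_of_mem hy, smul_eq_mul, mul_one, Pi.zero_apply] at this
    exact (pow_pos hpos _).ne' this

lemma volume_nndist_preimage_ne_zero (hd : 1 ≤ d) {S : Set ℝ≥0} (hSm : MeasurableSet S)
    (hS : 0 < volume ((fun r : ℝ≥0 => (r : ℝ)) '' S)) (y : EuclideanSpace ℝ (Fin d)) :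
    volume {x : EuclideanSpace ℝ (Fin d) | nndist x y ∈ S} ≠ 0 := by
  have h := (measurePreserving_sub_right volume y).measure_preimage
    (s := {x : EuclideanSpace ℝ (Fin d) | ‖x‖₊ ∈ S}) (measurable_nnnorm hSm).nullMeasurableSet
  have h1 : (fun x => x - y) ⁻¹' {x : EuclideanSpace ℝ (Fin d) | ‖x‖₊ ∈ S} =
      {x | nndist x y ∈ S} := by
    ext x; simp [nndist_eq_nnnorm]
  rw [← h1, h]
  exact volume_nnnorm_preimage_ne_zero hd hS

lemma volume_eq_zero_of_ae_not_mem_pair {T : Set (EuclideanSpace ℝ (Fin d))}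
    (h : ∀ᵐ q : Fin 2 → EuclideanSpace ℝ (Fin d), ¬ (q 0 ∈ T ∧ q 1 ∈ T)) : volume T = 0 := by
  have h1 : {q : Fin 2 → EuclideanSpace ℝ (Fin d) | ¬ ¬ (q 0 ∈ T ∧ q 1 ∈ T)} =
      Set.univ.pi fun _ => T := by
    ext q; simp [Fin.forall_fin_two]
  rw [ae_iff, h1, volume_pi_pi] at h
  simpa using h

/-- The edges of the complete bipartite graph `K_{2,2}`, a cycle of length four. -/
def fourCycle (k : Fin 2 × Fin 2) : (Fin 2 ⊕ Fin 2) × (Fin 2 ⊕ Fin 2) := (.inl k.1, .inr k.2)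

lemma isEdgeFamily_fourCycle : IsEdgeFamily fourCycle := by
  constructor
  · simp [fourCycle]
  · rintro ⟨a, b⟩ ⟨a', b'⟩ h
    simpa [fourCycle] using h

/-- Four-cycles with all sides in a set of distances of positive measure have positive measure. -/
lemma not_ae_exists_nndist_notMem (hd : 1 ≤ d) {S : Set ℝ≥0} (hSm : MeasurableSet S)
    (hS : 0 < volume ((fun r : ℝ≥0 => (r : ℝ)) '' S)) :
    ¬ ∀ᵐ x : Fin 2 ⊕ Fin 2 → EuclideanSpace ℝ (Fin d),
      ∃ k, nndist (x (fourCycle k).1) (x (fourCycle k).2) ∉ S := by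
  intro h
  have h1 := (volume_measurePreserving_sumPiEquivProdPi_symm
    fun _ : Fin 2 ⊕ Fin 2 => EuclideanSpace ℝ (Fin d)).quasiMeasurePreserving.ae h
  have h2 := Measure.ae_ae_of_ae_prod h1
  -- For fixed `p`, a four-cycle is a pair of points in the set `T` of `y` at allowed distances from
  -- both `p 0` and `p 1`. Since `T × T` is null, `T` is null.
  have h3 : ∀ᵐ p : Fin 2 → EuclideanSpace ℝ (Fin d), ∀ᵐ y : EuclideanSpace ℝ (Fin d),
      ¬ (nndist (p 0) y ∈ S ∧ nndist (p 1) y ∈ S) := by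
    filter_upwards [h2] with p hp
    have := volume_eq_zero_of_ae_not_mem_pair
      (T := {y | nndist (p 0) y ∈ S ∧ nndist (p 1) y ∈ S}) (by
        filter_upwards [hp] with q hq
        rintro ⟨⟨h00, h10⟩, h01, h11⟩
        obtain ⟨⟨a, b⟩, hab⟩ := hq
        fin_cases a <;> fin_cases b
        · exact hab h00
        · exact hab h01
        · exact hab h10
        · exact hab h11)
    rw [ae_iff]
    simpa using this
  -- The same argument with the roles exchanged: for some `y`, the pairs at allowed distances from
  -- `y` are null, hence so is the set of points at an allowed distance.
  rw [Measure.ae_ae_comm] at h3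
  · obtain ⟨y, hy⟩ := h3.exists
    exact volume_nndist_preimage_ne_zero hd hSm hS y
      (volume_eq_zero_of_ae_not_mem_pair (T := {x | nndist x y ∈ S}) hy)
  · have hm : ∀ i : Fin 2, MeasurableSet
        {z : (Fin 2 → EuclideanSpace ℝ (Fin d)) × EuclideanSpace ℝ (Fin d) |
          nndist (z.1 i) z.2 ∈ S} := fun i =>
      (((measurable_pi_apply i).comp measurable_fst).nndist measurable_snd) hSm
    exact ((hm 0).inter (hm 1)).compl

lemma sum_labels_fourCycle (F : ℤˣ → ℤˣ → ℤˣ → ℤˣ → ℝ) :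
    ∑ s : Fin 2 ⊕ Fin 2 → ℤˣ, F (s (.inl 0)) (s (.inl 1)) (s (.inr 0)) (s (.inr 1)) =
      ∑ a, ∑ b, ∑ c, ∑ e, F a b c e := by
  have h := Fintype.sum_equiv ((Equiv.sumArrowEquivProdArrow (Fin 2) (Fin 2) ℤˣ).trans
    ((finTwoArrowEquiv ℤˣ).prodCongr (finTwoArrowEquiv ℤˣ)))
    (fun s => F (s (.inl 0)) (s (.inl 1)) (s (.inr 0)) (s (.inr 1)))
    (fun z => F z.1.1 z.1.2 z.2.1 z.2.2) fun s => rfl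
  rw [h]
  simp only [Fintype.sum_prod_type]

lemma edgeWeight_eq_ofReal {fin fout : ℝ≥0 → ℝ}
    (h0 : ∀ s t r, 0 ≤ edgeProb fin fout s t r) {ι K : Type} [Fintype ι] [DecidableEq ι]
    [Fintype K] (e : K → ι × ι) (x : ι → EuclideanSpace ℝ (Fin d)) :
    edgeWeight fin fout e x = ENNReal.ofReal (∑ s : ι → ℤˣ, (2⁻¹ : ℝ) ^ Fintype.card ι *
      ∏ k, edgeProb fin fout (s (e k).1) (s (e k).2) (nndist (x (e k).1) (x (e k).2))) := by
  rw [ENNReal.ofReal_sum_of_nonneg fun s _ => mul_nonneg (by positivity)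
    (Finset.prod_nonneg fun k _ => h0 _ _ _)]
  refine Finset.sum_congr rfl fun s _ => ?_
  rw [ENNReal.ofReal_mul (by positivity), ENNReal.ofReal_prod_of_nonneg fun k _ => h0 _ _ _,
    ENNReal.ofReal_pow (by positivity), ENNReal.ofReal_inv_of_pos two_pos, ENNReal.ofReal_ofNat]

lemma edgeWeight_le_one {fin fout : ℝ≥0 → ℝ}
    (h1 : ∀ s t r, edgeProb fin fout s t r ≤ 1) {ι K : Type} [Fintype ι] [DecidableEq ι]
    [Fintype K] (e : K → ι × ι) (x : ι → EuclideanSpace ℝ (Fin d)) :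
    edgeWeight fin fout e x ≤ 1 := by
  calc edgeWeight fin fout e x ≤ ∑ _s : ι → ℤˣ, (2⁻¹ : ℝ≥0∞) ^ Fintype.card ι * 1 := by
        refine Finset.sum_le_sum fun s _ => mul_le_mul_right (Finset.prod_le_one' fun k _ => ?_) _
        exact ENNReal.ofReal_le_one.2 (h1 _ _ _)
    _ = 1 := by
        -- The pattern without edges has weight one, which says that the label weights sum to one.
        have := edgeWeight_self (fun _ => (1 : ℝ)) (fun k : Empty => k.elim) x
        simpa [edgeWeight] using this

/-- The average over labels of the probability of a four-cycle is the sum of the two products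
coming from the mean and from the difference of the connection functions. -/
lemma average_labels_fourCycle (fin fout : ℝ≥0 → ℝ) (r : Fin 2 × Fin 2 → ℝ≥0) :
    ∑ s : Fin 2 ⊕ Fin 2 → ℤˣ, (2⁻¹ : ℝ) ^ Fintype.card (Fin 2 ⊕ Fin 2) *
      ∏ k, edgeProb fin fout (s (fourCycle k).1) (s (fourCycle k).2) (r k) =
      ∏ k, (fin (r k) + fout (r k)) / 2 + ∏ k, (fin (r k) - fout (r k)) / 2 := by
  have h : (1 : ℤˣ) ≠ -1 := by decide
  simp only [Fintype.prod_prod_type, Fin.prod_univ_two, fourCycle]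
  rw [sum_labels_fourCycle fun a b c e => (2⁻¹ : ℝ) ^ Fintype.card (Fin 2 ⊕ Fin 2) *
    (edgeProb fin fout a c (r (0, 0)) * edgeProb fin fout a e (r (0, 1)) *
      (edgeProb fin fout b c (r (1, 0)) * edgeProb fin fout b e (r (1, 1))))]
  simp only [UnitsInt.univ, Finset.sum_pair h, edgeProb, if_true, h, h.symm, if_false,
    Fintype.card_sum, Fintype.card_fin]
  ring

lemma average_labels_edge (fin fout : ℝ≥0 → ℝ) (k : Fin 2 × Fin 2) (r : ℝ≥0) :
    ∑ s : Fin 2 ⊕ Fin 2 → ℤˣ, (2⁻¹ : ℝ) ^ Fintype.card (Fin 2 ⊕ Fin 2) *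
      edgeProb fin fout (s (fourCycle k).1) (s (fourCycle k).2) r = (fin r + fout r) / 2 := by
  have h : (1 : ℤˣ) ≠ -1 := by decide
  obtain ⟨a, b⟩ := k
  have hF : ∀ s : Fin 2 ⊕ Fin 2 → ℤˣ, edgeProb fin fout (s (fourCycle (a, b)).1)
      (s (fourCycle (a, b)).2) r = edgeProb fin fout (![s (.inl 0), s (.inl 1)] a)
        (![s (.inr 0), s (.inr 1)] b) r := fun s => by
    fin_cases a <;> fin_cases b <;> rfl
  simp only [hF]
  rw [sum_labels_fourCycle fun a' b' c' e' => (2⁻¹ : ℝ) ^ Fintype.card (Fin 2 ⊕ Fin 2) *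
    edgeProb fin fout (![a', b'] a) (![c', e'] b) r]
  fin_cases a <;> fin_cases b <;>
  · simp [UnitsInt.univ, Finset.sum_pair h, edgeProb, h, h.symm]
    ring

end FourCycle

end SpatialPlantedPartition

/-! ### Single edges and four-cycles distinguish the two models -/

namespace SpatialPlantedPartition

/-- The planted partition and the random connection model give different probabilities to some
pattern in disjoint boxes. -/
theorem exists_lintegral_edgeWeight_ne {d : ℕ} (hd : 1 ≤ d) {lam : ℝ≥0} (hlam : 0 < lam)
    {fin fout g : ℝ≥0 → ℝ} (hfin : Measurable fin) (hfout : Measurable fout) (hg : Measurable g)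
    (hf : ∀ r, 1 ≥ fin r ∧ fin r ≥ fout r ∧ fout r ≥ 0)
    (hne : 0 < volume ((fun r : ℝ≥0 => (r : ℝ)) '' {r | fin r ≠ fout r}))
    (hg' : ∀ r, g r ∈ Set.Icc (0 : ℝ) 1) :
    ∃ (K : Type) (_ : Fintype K) (e : K → (Fin 2 ⊕ Fin 2) × (Fin 2 ⊕ Fin 2))
      (B : Fin 2 ⊕ Fin 2 → Set (EuclideanSpace ℝ (Fin d))), IsEdgeFamily e ∧
      (∀ i, MeasurableSet (B i)) ∧ (∀ i, Bornology.IsBounded (B i)) ∧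
      Pairwise (Function.onFun Disjoint B) ∧
      ∫⁻ x, edgeWeight fin fout e x ∂Measure.pi (fun i => boxMeasure lam (B i)) ≠
        ∫⁻ x, edgeWeight g g e x ∂Measure.pi fun i => boxMeasure lam (B i) := by
  by_contra! hcon
  have h0 : ∀ s t r, 0 ≤ edgeProb fin fout s t r := fun s t r => by
    unfold edgeProb
    obtain ⟨h1, h2, h3⟩ := hf r
    split_ifs <;> linarith
  have hae : ∀ (K : Type) [Fintype K] (e : K → (Fin 2 ⊕ Fin 2) × (Fin 2 ⊕ Fin 2)),
      IsEdgeFamily e → ∀ᵐ x : Fin 2 ⊕ Fin 2 → EuclideanSpace ℝ (Fin d),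
        edgeWeight fin fout e x = edgeWeight g g e x := fun K _ e he =>
    ae_edgeWeight_eq hd hlam hfin hfout hg hg e (edgeWeight_le_one (edgeProb_le_one hf) e)
      fun B hB hb hdisj => hcon K inferInstance e B he hB hb hdisj
  have hcycle := hae (Fin 2 × Fin 2) fourCycle isEdgeFamily_fourCycle
  -- Each edge is kept on the four vertices of the cycle, so that both identities hold at the same
  -- `x`.
  have hedge : ∀ᵐ x : Fin 2 ⊕ Fin 2 → EuclideanSpace ℝ (Fin d), ∀ k,
      edgeWeight fin fout (fun _ : Unit => fourCycle k) x =
        edgeWeight g g (fun _ : Unit => fourCycle k) x :=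
    ae_all_iff.2 fun k => hae Unit _
      ⟨fun _ => isEdgeFamily_fourCycle.1 k, Function.injective_of_subsingleton _⟩
  refine not_ae_exists_nndist_notMem hd (measurableSet_eq_fun hfin hfout).compl hne ?_
  filter_upwards [hcycle, hedge] with x h1 h2
  by_contra! hall
  let r : Fin 2 × Fin 2 → ℝ≥0 := fun k => nndist (x (fourCycle k).1) (x (fourCycle k).2)
  have hmean : ∀ k, (fin (r k) + fout (r k)) / 2 = g (r k) := fun k => by
    have h := h2 k
    rw [edgeWeight_eq_ofReal h0, edgeWeight_self] at h
    simp only [Finset.univ_unique, Finset.prod_singleton] at h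
    rw [average_labels_edge] at h
    obtain ⟨_, h3, h4⟩ := hf (r k)
    exact (ENNReal.ofReal_eq_ofReal_iff (by linarith) (hg' _).1).1 h
  rw [edgeWeight_eq_ofReal h0, edgeWeight_self, average_labels_fourCycle _ _ r,
    ← ENNReal.ofReal_prod_of_nonneg fun k _ => (hg' _).1] at h1
  have hpos : 0 < ∏ k, (fin (r k) - fout (r k)) / 2 := Finset.prod_pos fun k _ => by
    have h3 : fin (r k) ≠ fout (r k) := hall k
    have h4 := lt_of_le_of_ne (hf (r k)).2.1 h3.symm
    linarith
  have hg0 : 0 ≤ ∏ k, g (r k) := Finset.prod_nonneg fun k _ => (hg' _).1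
  -- With the means replaced by `g`, this reads `∏ g + ∏ δ = ∏ g`, against `∏ δ > 0`.
  have h5 := (ENNReal.ofReal_eq_ofReal_iff (by simp only [hmean]; linarith) hg0).1 h1
  simp only [hmean] at h5
  linarith

end SpatialPlantedPartition

theorem theorem3 {d : ℕ} (hd : 1 ≤ d) (lam : ℝ≥0) (hlam : 0 < lam)
    (fin fout g : ℝ≥0 → ℝ)
    (hfin_meas : Measurable fin) (hfout_meas : Measurable fout) (hg_meas : Measurable g)
    (hf : ∀ r, 1 ≥ fin r ∧ fin r ≥ fout r ∧ fout r ≥ 0)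
    (hne : 0 < volume ((fun r : ℝ≥0 => (r : ℝ)) '' {r | fin r ≠ fout r}))
    (hg : ∀ r, g r ∈ Set.Icc (0 : ℝ) 1)
    {Ω Ω' : Type*} [MeasurableSpace Ω] [MeasurableSpace Ω']
    (P : Measure Ω) [IsProbabilityMeasure P] (P' : Measure Ω') [IsProbabilityMeasure P']
    (X : ℕ → Ω → EuclideanSpace ℝ (Fin d)) (Z : ℕ → Ω → ℤˣ) (U : Sym2 ℕ → Ω → ℝ)
    (hG : SpatialPlantedPartition.IsPlantedPartitionData P lam X Z U)
    (X' : ℕ → Ω' → EuclideanSpace ℝ (Fin d)) (U' : Sym2 ℕ → Ω' → ℝ)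
    (hH : SpatialPlantedPartition.IsConnectionData P' lam X' U') :
    AEMeasurable (SpatialPlantedPartition.plantedPartitionGraph fin fout X Z U) P ∧
    AEMeasurable (SpatialPlantedPartition.randomConnectionGraph g X' U') P' ∧
    (P.map (SpatialPlantedPartition.plantedPartitionGraph fin fout X Z U)) ⟂ₘ
      (P'.map (SpatialPlantedPartition.randomConnectionGraph g X' U')) := by
  obtain ⟨K, _, e, B, he, hB, hb, hdisj, hlt⟩ :=
    SpatialPlantedPartition.exists_lintegral_edgeWeight_ne hd hlam hfin_meas hfout_meas hg_meas
      hf hne hg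
  have hΓ := hG.hasEdgeLaw hfin_meas hfout_meas hf
  have hΓ' := hH.hasEdgeLaw hg_meas hg
  exact ⟨SpatialPlantedPartition.aemeasurable_randomGraph hG.points hΓ.measurableSet_adj,
    SpatialPlantedPartition.aemeasurable_randomGraph hH.points hΓ'.measurableSet_adj,
    SpatialPlantedPartition.mutuallySingular_of_lintegral_edgeWeight_ne hd hG.points hH.points
      hfin_meas hfout_meas hg_meas hg_meas hΓ hΓ' he hB hb hdisj hlt⟩
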